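/- \textbf{Model.} Time is slotted. In each slot a random number of requests with law $\alpha$ on $\{0,1,2,\dots\}$ and finite mean $\lambda$ arrives; each request carries $v_p\ge 1$ prefill tokens, $v_d\ge 1$ decode tokens and a feature $z$ in a finite set. The numbers of arrivals are i.i.d., the triples $(v_p,v_d,z)$ are i.i.d. with law $\nu$ (the components may be dependent), the two sequences are independent, and $m_p=\mathbb E[v_p]$, $m_d=\mathbb E[v_d]$ are finite. There are $K\ge 1$ identical engines. The state of an engine consists of the remaining time $r$ of its current batch and the list, in order of arrival, of $(p_i,d_i,z_i)$ for its requests $i$ that have not departed, where $p_i,d_i$ are the numbers of prefill and decode tokens not yet loaded. When $r=0$, a scheduling algorithm $\pi$ (a function of the queue of the engine, the same for all engines) chooses $(\delta^p_i,\delta^d_i)$ with $\delta^p_i\le p_i$, $\delta^d_i\le 1$, $\delta_i^d=0$ if $p_i>0$, and $b':=\sum_i(\delta^p_i+\delta^d_i)\le b$ ($b$ is the token budget). Then $p_i,d_i$ are reduced by $\delta^p_i,\delta^d_i$, requests with $d_i=0$ leave, and $r$ becomes $t_{b'}-1$; when $r>0$, nothing is loaded and $r$ decreases by one. Here $n\mapsto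 t_n$ is a nondecreasing function with positive integer values (for instance $t_n=c+a\max(0,n-b_0)$ with integers $c\ge1$, $a,b_0\ge0$). The algorithm $\pi$ is \emph{work-conserving} if the batch is full whenever possible and otherwise contains every available token, that is, $b'=\min\bigl(b,\sum_i(p_i+\mathbf 1\{p_i=0\})\bigr)$. It is \emph{$(K_p,K_d)$-FCFS} ($K_p,K_d\ge1$) if prefill tokens are loaded only from the $K_p$ oldest requests with $p_i>0$, and decode tokens only from the $K_d$ oldest requests with $p_i=0$. Both properties are required at the states that the system can reach. At the end of each slot the new requests are routed one after the other to the engines by a load-balancing algorithm, which is one of the following: each request is assigned to an engine uniformly at random; each request joins an engine with the least number of requests; each request joins an engine with the least number of outstanding tokens $\sum_i(p_i+d_i)$. In the last two cases ties are broken by an arbitrary, possibly random, rule depending on the current state. The states of all engines together form a discrete-time Markov chain. Its state space $\mathcal X$ is the set of all states that can be reached from the empty system (no requests, $r=0$ at all engines), and the chain is assumed to be irreducible on $\mathcal X$. \textbf{Proposition.} Fix one of these load-balancing algorithms, and a work-conserving $(K_p,K_d)$-FCFS scheduling algorithm that is used in all engines. If $$\lambda\,(m_p+m_d)<\frac{K\,b}{t_b},$$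 then the Markov chain describing the system is positive recurrent: for every $x\in\mathcal X$, the mean time of the first return to $x$ is finite. -/

import Mathlib

open scoped ENNReal

noncomputable section

namespace LLMServing

/-! ### Requests, batches and scheduling algorithms -/

/-- A request that has not departed: its unprocessed prefill tokens, its unprocessed decode
tokens (tokens of the batch in process are not counted) and its feature. -/
structure Request (Z : Type*) where
  prefill : ℕ
  decode : ℕ
  feature : Z

/-- A scheduling algorithm with token budget `b`. It looks at the queue of an engine that is ready
to form a batch (the requests are listed in order of arrival, oldest first) and puts `δp Q i`
prefill tokens and `δd Q i` decode tokens of the `i`-th request into the batch. -/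
structure Scheduler (Z : Type*) (b : ℕ) where
  δp : (Q : List (Request Z)) → Fin Q.length → ℕ
  δd : (Q : List (Request Z)) → Fin Q.length → ℕ
  prefill_first : ∀ Q i, 0 < (Q.get i).prefill → δd Q i = 0
  prefill_le : ∀ Q i, δp Q i ≤ (Q.get i).prefill
  decode_le_one : ∀ Q i, δd Q i ≤ 1
  budget : ∀ Q, ∑ i, (δp Q i + δd Q i) ≤ b

variable {Z : Type*} {b K : ℕ}

/-- The token load `b'` of the batch formed from the queue `Q`. -/
def Scheduler.load (π : Scheduler Z b) (Q : List (Request Z)) : ℕ :=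
  ∑ i, (π.δp Q i + π.δd Q i)

/-- The number of tokens that could be put into one batch if there were no budget: all unprocessed
prefill tokens of a request in the prefill phase, one token of a request in the decode phase. -/
def available (Q : List (Request Z)) : ℕ :=
  ∑ i : Fin Q.length, ((Q.get i).prefill + if (Q.get i).prefill = 0 then 1 else 0)

/-- Work conservation at the queue `Q`: the batch is full whenever `b` tokens are available, and
otherwise it contains all available tokens. -/
def Scheduler.WorkConservingAt (π : Scheduler Z b) (Q : List (Request Z)) : Prop :=
  π.load Q = min b (available Q)

/-- The `(Kp, Kd)`-FCFS property at the queue `Q`: prefill tokens are loaded only from the `Kp`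
oldest requests in the prefill phase, decode tokens only from the `Kd` oldest requests in the
decode phase. -/
def Scheduler.FCFSAt (π : Scheduler Z b) (Kp Kd : ℕ) (Q : List (Request Z)) : Prop :=
  ∀ i : Fin Q.length,
    (0 < π.δp Q i →
      (Finset.univ.filter fun j : Fin Q.length => j < i ∧ 0 < (Q.get j).prefill).card < Kp) ∧
    (0 < π.δd Q i →
      (Finset.univ.filter fun j : Fin Q.length => j < i ∧ (Q.get j).prefill = 0).card < Kd)

/-! ### One engine -/

/-- The state of an engine: remaining number of slots of the current batch, and the requests that
have not departed, in order of arrival. -/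
structure EngineState (Z : Type*) where
  remaining : ℕ
  queue : List (Request Z)

/-- The queue after the batch chosen by `π` has been taken out; requests without unprocessed
decode tokens leave. -/
def Scheduler.loadBatch (π : Scheduler Z b) (Q : List (Request Z)) : List (Request Z) :=
  (List.ofFn fun i : Fin Q.length =>
    ({ prefill := (Q.get i).prefill - π.δp Q i
       decode := (Q.get i).decode - π.δd Q i
       feature := (Q.get i).feature } : Request Z)).filter fun q => q.decode ≠ 0

/-- The state of an engine at the end of a slot, before the arrivals of the slot are added. A batch
with token load `b'` takes `t b'` slots; a new one is formed only if none is in process. -/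
def EngineState.serve (t : ℕ → ℕ) (π : Scheduler Z b) (e : EngineState Z) : EngineState Z :=
  if e.remaining = 0 then ⟨t (π.load e.queue) - 1, π.loadBatch e.queue⟩
  else ⟨e.remaining - 1, e.queue⟩

/-- A new request, given by its token numbers and its feature, joins at the end of the queue. -/
def EngineState.push (e : EngineState Z) (v : ℕ+ × ℕ+ × Z) : EngineState Z :=
  ⟨e.remaining, e.queue ++ [⟨v.1, v.2.1, v.2.2⟩]⟩

/-- The number of requests of an engine. -/
def EngineState.numRequests (e : EngineState Z) : ℕ := e.queue.length

/-- The number of outstanding (unprocessed) tokens of an engine. -/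
def EngineState.numTokens (e : EngineState Z) : ℕ :=
  (e.queue.map fun q => q.prefill + q.decode).sum

/-! ### `K` parallel engines -/

/-- The state of the whole system. -/
abbrev SystemState (K : ℕ) (Z : Type*) := Fin K → EngineState Z

/-- The system without requests and without a batch in process. -/
def emptySystem (K : ℕ) (Z : Type*) : SystemState K Z := fun _ => ⟨0, []⟩

/-- A routing rule: the distribution of the engine to which a request is sent, given the current
state of the system. -/
abbrev Router (K : ℕ) (Z : Type*) := SystemState K Z → PMF (Fin K)

/-- Every request is assigned uniformly at random. -/
def Router.IsUniform [NeZero K] (ρ : Router K Z) : Prop :=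
  ∀ s, ρ s = PMF.uniformOfFintype (Fin K)

/-- Every request joins an engine with the least number of requests (ties are broken by an
arbitrary, possibly random, rule). -/
def Router.IsLeastRequests (ρ : Router K Z) : Prop :=
  ∀ s, ∀ k ∈ (ρ s).support, ∀ j, (s k).numRequests ≤ (s j).numRequests

/-- Every request joins an engine with the least number of outstanding tokens (ties are broken by
an arbitrary, possibly random, rule). -/
def Router.IsLeastTokens (ρ : Router K Z) : Prop :=
  ∀ s, ∀ k ∈ (ρ s).support, ∀ j, (s k).numTokens ≤ (s j).numTokens

/-- The load-balancing algorithms: random assignment, join-the-least-requests and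
join-the-least-tokens. -/
def Router.IsLoadBalancing [NeZero K] (ρ : Router K Z) : Prop :=
  ρ.IsUniform ∨ ρ.IsLeastRequests ∨ ρ.IsLeastTokens

/-- The law of the system after `n` new requests, with independent token numbers and features of
law `ν`, have been routed one after the other, each on the basis of the then current state. -/
def addArrivals (ν : PMF (ℕ+ × ℕ+ × Z)) (ρ : Router K Z) : ℕ → SystemState K Z → PMF (SystemState K Z)
  | 0, s => PMF.pure s
  | n + 1, s => ν.bind fun v => (ρ s).bind fun k =>
      addArrivals ν ρ n (Function.update s k ((s k).push v))

/-- The transition probabilities of the Markov chain: every engine is served with the same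
scheduler, and then a number of new requests of law `α` arrives. -/
def step (t : ℕ → ℕ) (α : PMF ℕ) (ν : PMF (ℕ+ × ℕ+ × Z)) (π : Scheduler Z b) (ρ : Router K Z)
    (s : SystemState K Z) : PMF (SystemState K Z) :=
  α.bind fun n => addArrivals ν ρ n fun k => (s k).serve t π

end LLMServing

/-! ### Markov chains in discrete time -/

namespace MarkovChain

variable {S : Type*}

/-- `y` can be reached from `x` in zero or more steps, each of positive probability. -/
def Reachable (P : S → PMF S) : S → S → Prop :=
  Relation.ReflTransGen fun x y => y ∈ (P x).support

/-- All states that the chain can take when it starts in `x₀`. -/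
def stateSpace (P : S → PMF S) (x₀ : S) : Set S := {x | Reachable P x₀ x}

/-- Any two states of `A` communicate. -/
def IsIrreducibleOn (P : S → PMF S) (A : Set S) : Prop :=
  ∀ x ∈ A, ∀ y ∈ A, Reachable P x y

open scoped Classical in
/-- The probability that the chain started in `y` is not in `x` at any of the times `1, …, n`
(by conditioning on the first step). -/
def avoidProb (P : S → PMF S) (x : S) : ℕ → S → ℝ≥0∞
  | 0, _ => 1
  | n + 1, y => ∑' z, if z = x then 0 else P y z * avoidProb P x n z

/-- The mean return time `E_x[T]`, `T = inf {n ≥ 1 | X_n = x}`, as `∑ₙ P_x(T > n)`; it is infinite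
if `T` is infinite with positive probability. -/
def meanReturnTime (P : S → PMF S) (x : S) : ℝ≥0∞ := ∑' n, avoidProb P x n x

/-- Every state of `A` is positive recurrent. -/
def IsPositiveRecurrentOn (P : S → PMF S) (A : Set S) : Prop :=
  ∀ x ∈ A, meanReturnTime P x < ∞

end MarkovChain

end

/-! The proof applies Foster's criterion, `isPositiveRecurrentOn_of_drift`, to a sum of two kinds of
Lyapunov functions.

The work of an engine is measured by its level `t b * total u + b * remaining`. A running batch
lowers it by `b` per slot, and so does the formation of a full batch, up to tokens that `u` does not
count. By work conservation (`Scheduler.WorkConservingAt.full_or`) a batch that is not full advances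
every request, and there are at most `b` of them. Then either a request with more than `L` tokens
advances, or the level is below a constant (`level_serve`). The first Lyapunov function is the
primitive of a very slowly growing `g`, with values in [0, 1], at the level, plus a multiple of the
excess over `L`. Service contributes about `-b * g(level)` per engine (`lyapunov_serve`), an arrival
about `t b * size * g(level)` at the engine it joins (`lyapunov_push`). Slow growth turns bounded
factors between levels into small additive errors of `g`, so each routing rule picks, in the mean,
an engine where `g` is at most average up to a small error (`exists_balances`). Hence the drift is
at most `(t b * λ * (m_p + m_d) - K * b)` times the average of `g`, plus a small error; it is
negative once some level is high. Since `g ≤ 1`, dominated convergence makes first moments suffice.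

For join-the-least-requests `u` truncates at `L`, so low levels bound the number of requests but not
their tokens, and the set of such states is infinite. Giant requests need the second kind
(`expect_step_giantLyapunov`): while a request has more than `ℓ` tokens, each slot of service
advances such a request or reduces the level of the small ones, and slots without arrivals have
positive probability. This gives a negative drift, tiny if the small requests carry much work,
against an error that vanishes as `ℓ` grows. Thresholds are chosen recursively, each making its
error negligible against the gain determined by its predecessor. With fewer requests than
thresholds, some gap between consecutive thresholds contains no token number (`exists_gap`), and the
upper end of that gap gives a sufficient gain. -/

noncomputable section

/-! ### Discrete expectations, taboo probabilities and Foster's criterion. -/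

namespace MarkovChain

variable {S : Type*}

/-- The expectation of a nonnegative function under a discrete law. -/
def expect (p : PMF S) (f : S → ℝ≥0∞) : ℝ≥0∞ := ∑' z, p z * f z

lemma expect_mono_support {p : PMF S} {f g : S → ℝ≥0∞} (h : ∀ z ∈ p.support, f z ≤ g z) :
    expect p f ≤ expect p g := by
  refine ENNReal.tsum_le_tsum fun z => ?_
  by_cases hz : p z = 0
  · simp [hz]
  · exact mul_le_mul_right (h z ((PMF.mem_support_iff _ _).2 hz)) _

lemma expect_mono {p : PMF S} {f g : S → ℝ≥0∞} (h : ∀ z, f z ≤ g z) :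
    expect p f ≤ expect p g := expect_mono_support fun z _ => h z

lemma expect_add (p : PMF S) (f g : S → ℝ≥0∞) :
    expect p (fun z => f z + g z) = expect p f + expect p g := by
  simp only [expect, mul_add, ENNReal.tsum_add]

lemma expect_const_mul (p : PMF S) (c : ℝ≥0∞) (f : S → ℝ≥0∞) :
    expect p (fun z => c * f z) = c * expect p f := by
  simp only [expect, mul_left_comm _ c, ENNReal.tsum_mul_left]

lemma expect_mul_const (p : PMF S) (c : ℝ≥0∞) (f : S → ℝ≥0∞) :
    expect p (fun z => f z * c) = expect p f * c := by
  simp only [mul_comm _ c, expect_const_mul]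

lemma expect_const (p : PMF S) (c : ℝ≥0∞) : expect p (fun _ => c) = c := by
  simp only [expect, ENNReal.tsum_mul_right, p.tsum_coe, one_mul]

lemma expect_pure (s : S) (f : S → ℝ≥0∞) : expect (PMF.pure s) f = f s := by
  unfold expect
  rw [tsum_eq_single s]
  · simp
  · intro z hz
    simp [PMF.pure_apply, hz]

lemma expect_bind {R : Type*} (p : PMF R) (q : R → PMF S) (f : S → ℝ≥0∞) :
    expect (p.bind q) f = expect p fun a => expect (q a) f := by
  simp only [expect, PMF.bind_apply, ← ENNReal.tsum_mul_right, ← ENNReal.tsum_mul_left]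
  rw [ENNReal.tsum_comm]
  simp only [mul_assoc]

lemma expect_finset_sum {ι : Type*} (p : PMF S) (s : Finset ι) (f : ι → S → ℝ≥0∞) :
    expect p (fun z => ∑ i ∈ s, f i z) = ∑ i ∈ s, expect p (f i) := by
  simp only [expect, Finset.mul_sum]
  exact Summable.tsum_finsetSum fun i _ => ENNReal.summable

open scoped Classical in
/-- The expectation of `f` after one step, on the event that the chain is not in `x`. -/
def taboo (P : S → PMF S) (x : S) (f : S → ℝ≥0∞) (y : S) : ℝ≥0∞ :=
  expect (P y) fun z => if z = x then 0 else f z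

lemma avoidProb_succ (P : S → PMF S) (x : S) (n : ℕ) (y : S) :
    avoidProb P x (n + 1) y = taboo P x (avoidProb P x n) y := by
  unfold taboo expect
  rw [avoidProb]
  refine tsum_congr fun z => ?_
  by_cases hz : z = x <;> simp [hz]

lemma taboo_add (P : S → PMF S) (x : S) (f g : S → ℝ≥0∞) (y : S) :
    taboo P x (fun z => f z + g z) y = taboo P x f y + taboo P x g y := by
  unfold taboo
  rw [← expect_add]
  congr 1
  ext z
  split_ifs <;> simp

lemma taboo_const_mul (P : S → PMF S) (x : S) (c : ℝ≥0∞) (f : S → ℝ≥0∞) (y : S) :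
    taboo P x (fun z => c * f z) y = c * taboo P x f y := by
  unfold taboo
  rw [← expect_const_mul]
  congr 1
  ext z
  split_ifs <;> simp

lemma taboo_sum (P : S → PMF S) (x : S) (f : ℕ → S → ℝ≥0∞) (N : ℕ) (y : S) :
    taboo P x (fun z => ∑ n ∈ Finset.range N, f n z) y
      = ∑ n ∈ Finset.range N, taboo P x (f n) y := by
  unfold taboo
  rw [← expect_finset_sum]
  congr 1
  ext z
  split_ifs <;> simp

lemma taboo_le_expect (P : S → PMF S) (x : S) (f : S → ℝ≥0∞) (y : S) :
    taboo P x f y ≤ expect (P y) f :=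
  expect_mono fun z => by split_ifs <;> simp

lemma taboo_mono_support (P : S → PMF S) (x : S) {f g : S → ℝ≥0∞} {y : S}
    (h : ∀ z ∈ (P y).support, f z ≤ g z) : taboo P x f y ≤ taboo P x g y :=
  expect_mono_support fun z hz => by split_ifs <;> simp [h z hz]

lemma avoidProb_le_one (P : S → PMF S) (x : S) (n : ℕ) (y : S) : avoidProb P x n y ≤ 1 := by
  induction n generalizing y with
  | zero => simp [avoidProb]
  | succ n ih =>
    rw [avoidProb_succ]
    exact (taboo_le_expect _ _ _ _).trans ((expect_mono ih).trans (expect_const _ _).le)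

lemma avoidProb_antitone (P : S → PMF S) (x y : S) : Antitone fun n => avoidProb P x n y := by
  refine antitone_nat_of_succ_le fun n => ?_
  induction n generalizing y with
  | zero => exact avoidProb_le_one P x 1 y
  | succ n ih =>
    rw [avoidProb_succ, avoidProb_succ P x n]
    exact taboo_mono_support P x fun z _ => ih z

lemma expect_lt_one {p : PMF S} {f : S → ℝ≥0∞} (hf : ∀ z, f z ≤ 1) {z₀ : S}
    (hz₀ : z₀ ∈ p.support) (h : f z₀ < 1) : expect p f < 1 := by
  classical
  have h1 : (∑' z, p z) = 1 := p.tsum_coe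
  rw [← h1]
  refine ENNReal.tsum_lt_tsum (i := z₀) ?_ (fun z => ?_) ?_
  · refine ne_top_of_le_ne_top ENNReal.one_ne_top ?_
    rw [← h1]
    exact ENNReal.tsum_le_tsum fun z => mul_le_of_le_one_right' (hf z)
  · exact mul_le_of_le_one_right' (hf z)
  · have h0 : p z₀ ≠ 0 := (PMF.mem_support_iff _ _).1 hz₀
    calc p z₀ * f z₀ < p z₀ * 1 := ENNReal.mul_lt_mul_right h0 (PMF.apply_ne_top p z₀) h
      _ = p z₀ := mul_one _

/-- A finite path to `x` through a successor of `y` has positive probability. Starting from a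
successor matters because time 0 does not count as a visit. -/
lemma exists_avoidProb_lt_one {P : S → PMF S} {x y z : S} (hyz : z ∈ (P y).support)
    (h : Reachable P z x) : ∃ n, avoidProb P x n y < 1 := by
  induction h using Relation.ReflTransGen.head_induction_on generalizing y with
  | refl =>
    refine ⟨1, ?_⟩
    rw [avoidProb_succ]
    refine expect_lt_one (fun w => ?_) hyz (by simp)
    split_ifs <;> simp [avoidProb]
  | head hac _ ih =>
    obtain ⟨n, hn⟩ := ih hac
    refine ⟨n + 1, ?_⟩
    rw [avoidProb_succ]
    refine expect_lt_one (fun w => ?_) hyz ?_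
    · split_ifs <;> simp [avoidProb_le_one]
    · split_ifs <;> simp [hn]

/-- **Foster's criterion.** -/
theorem isPositiveRecurrentOn_of_drift {P : S → PMF S} {A C : Set S}
    (hclosed : ∀ x ∈ A, ∀ y ∈ (P x).support, y ∈ A) (hirr : IsIrreducibleOn P A)
    (hC : C.Finite) (V : S → ℝ≥0∞) (hV : ∀ x ∈ A, V x ≠ ∞) {δ M : ℝ≥0∞} (hδ : δ ≠ 0)
    (hδ' : δ ≠ ∞) (hM : M ≠ ∞) (hbound : ∀ x ∈ A, expect (P x) V ≤ V x + M)
    (hdrift : ∀ x ∈ A, x ∉ C → expect (P x) V + δ ≤ V x) :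
    IsPositiveRecurrentOn P A := by
  intro x hx
  have hlt : ∀ y ∈ A, ∃ n, avoidProb P x n y < 1 := by
    intro y hy
    obtain ⟨z, hz⟩ := (P y).support_nonempty
    exact exists_avoidProb_lt_one hz (hirr z (hclosed y hy z hz) x hx)
  choose! n hn using hlt
  obtain ⟨N, hN⟩ : ∃ N, ∀ y ∈ C, n y ≤ N := by
    obtain ⟨N, hN⟩ := (hC.image n).bddAbove
    exact ⟨N, fun y hy => hN ⟨y, hy, rfl⟩⟩
  -- By finiteness of `C`, `x` is hit within `N` steps with probability at least `p` from every
  -- state of `C ∩ A`.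
  obtain ⟨p, hp0, hp1, hp⟩ : ∃ p : ℝ≥0∞, p ≠ 0 ∧ p ≠ ∞ ∧
      ∀ y ∈ C ∩ A, avoidProb P x N y + p ≤ 1 := by
    have hfin : (C ∩ A).Finite := hC.subset Set.inter_subset_left
    rcases (C ∩ A).eq_empty_or_nonempty with he | hne
    · exact ⟨1, one_ne_zero, ENNReal.one_ne_top, by simp [he]⟩
    · obtain ⟨y₀, hy₀, hmax⟩ := Set.exists_max_image _ (avoidProb P x N) hfin hne
      have h1 : avoidProb P x N y₀ < 1 :=
        (avoidProb_antitone P x y₀ (hN y₀ hy₀.1)).trans_lt (hn y₀ hy₀.2)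
      refine ⟨1 - avoidProb P x N y₀, (tsub_pos_of_lt h1).ne',
        ENNReal.sub_ne_top ENNReal.one_ne_top, fun y hy => ?_⟩
      calc _ ≤ avoidProb P x N y₀ + (1 - avoidProb P x N y₀) := by gcongr; exact hmax y hy
        _ = 1 := add_tsub_cancel_of_le h1.le
  set B : S → ℝ≥0∞ := fun y => ∑ n ∈ Finset.range N, avoidProb P x n y with hB
  have hBN : ∀ y, B y ≤ N := fun y => by
    calc B y ≤ ∑ n ∈ Finset.range N, (1 : ℝ≥0∞) :=
          Finset.sum_le_sum fun n _ => avoidProb_le_one P x n y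
      _ = N := by simp
  -- `B` is the mean of the return time truncated at `N`. One taboo step shifts the sum, so `B`
  -- never increases, and on `C ∩ A` it drops by at least `p`.
  have hB' : ∀ y, taboo P x B y + 1 = B y + avoidProb P x N y := fun y => by
    have h1 : taboo P x B y = ∑ n ∈ Finset.range N, avoidProb P x (n + 1) y := by
      rw [hB, taboo_sum]
      exact Finset.sum_congr rfl fun n _ => (avoidProb_succ P x n y).symm
    have h2 : (1 : ℝ≥0∞) = avoidProb P x 0 y := by rw [avoidProb]
    rw [h1, h2, ← Finset.sum_range_succ' fun n => avoidProb P x n y, Finset.sum_range_succ]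
  have hBle : ∀ y, taboo P x B y ≤ B y := fun y => by
    refine (ENNReal.add_le_add_iff_right ENNReal.one_ne_top).1 ?_
    rw [hB']
    gcongr
    exact avoidProb_le_one P x N y
  -- With this weight the drop of `B` on `C` pays for the increase `M` of `V` and leaves `δ`.
  set c : ℝ≥0∞ := (M + δ) / p with hc
  have hcp : c * p = M + δ := ENNReal.div_mul_cancel hp0 hp1
  have hctop : c ≠ ∞ := ENNReal.div_ne_top (ENNReal.add_ne_top.2 ⟨hM, hδ'⟩) hp0
  set W : S → ℝ≥0∞ := fun y => V y + c * B y with hW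
  have hWdrift : ∀ y ∈ A, taboo P x W y + δ ≤ W y := by
    intro y hy
    rw [hW, taboo_add, taboo_const_mul]
    by_cases hyC : y ∈ C
    · have h1 : taboo P x B y + p ≤ B y := by
        have hfin : avoidProb P x N y ≠ ∞ :=
          ne_top_of_le_ne_top ENNReal.one_ne_top (avoidProb_le_one P x N y)
        refine (ENNReal.add_le_add_iff_right hfin).1 ?_
        rw [← hB', add_assoc, add_comm p]
        gcongr
        exact hp y ⟨hyC, hy⟩
      calc taboo P x V y + c * taboo P x B y + δ
          ≤ (V y + M) + c * taboo P x B y + δ := by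
            gcongr; exact (taboo_le_expect P x V y).trans (hbound y hy)
        _ = V y + c * (taboo P x B y + p) := by rw [mul_add, hcp]; ring
        _ ≤ V y + c * B y := by gcongr
    · calc taboo P x V y + c * taboo P x B y + δ
          ≤ expect (P y) V + c * B y + δ := by
            gcongr
            · exact taboo_le_expect P x V y
            · exact hBle y
        _ = (expect (P y) V + δ) + c * B y := by ring
        _ ≤ V y + c * B y := by gcongr; exact hdrift y hy hyC
  have hsum : ∀ m, ∀ y ∈ A, δ * ∑ n ∈ Finset.range m, avoidProb P x n y ≤ W y := by
    intro m
    induction m with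
    | zero => simp
    | succ m ih =>
      intro y hy
      have h1 : ∑ n ∈ Finset.range (m + 1), avoidProb P x n y
          = taboo P x (fun z => ∑ n ∈ Finset.range m, avoidProb P x n z) y + 1 := by
        rw [Finset.sum_range_succ', taboo_sum]
        congr 1
        exact Finset.sum_congr rfl fun n _ => avoidProb_succ P x n y
      rw [h1, mul_add, mul_one, ← taboo_const_mul]
      refine le_trans ?_ (hWdrift y hy)
      gcongr
      exact taboo_mono_support P x fun z hz => ih z (hclosed y hy z hz)
  have hWx : W x ≠ ∞ := ENNReal.add_ne_top.2 ⟨hV x hx, ENNReal.mul_ne_top hctop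
    (ne_top_of_le_ne_top (ENNReal.natCast_ne_top N) (hBN x))⟩
  have htot : δ * meanReturnTime P x ≤ W x := by
    unfold meanReturnTime
    rw [← ENNReal.tsum_mul_left, ENNReal.tsum_eq_iSup_nat]
    refine iSup_le fun m => ?_
    rw [← Finset.mul_sum]
    exact hsum m x hx
  rw [lt_top_iff_ne_top]
  intro h
  rw [h, ENNReal.mul_top hδ, top_le_iff] at htot
  exact hWx htot

end MarkovChain

/-! ### One slot of service in one engine. -/

namespace LLMServing

variable {Z : Type*} {b K : ℕ}

/-- The number of unprocessed tokens of a request. -/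
def Request.tokens (q : Request Z) : ℕ := q.prefill + q.decode

/-- The number of tokens of an arriving request. -/
def size (v : ℕ+ × ℕ+ × Z) : ℕ := v.1 + v.2.1

namespace EngineState

/-- The sum over the requests of an engine of a function of their unprocessed tokens. -/
def total (f : ℕ → ℕ) (e : EngineState Z) : ℕ := (e.queue.map fun q => f q.tokens).sum

/-- A weighted sum of `total f` and of the remaining time of the batch. -/
def level (b T : ℕ) (f : ℕ → ℕ) (e : EngineState Z) : ℕ := T * e.total f + b * e.remaining

/-- The number of unprocessed tokens beyond the first `ℓ` ones of each request. -/
def excess (ℓ : ℕ) (e : EngineState Z) : ℕ := e.total (· - ℓ)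

/-- Every request has an unprocessed decode token, and no batch lasts longer than `T`. -/
def Valid (T : ℕ) (e : EngineState Z) : Prop :=
  e.remaining ≤ T ∧ ∀ q ∈ e.queue, q.decode ≠ 0

lemma total_push (f : ℕ → ℕ) (e : EngineState Z) (v : ℕ+ × ℕ+ × Z) :
    (e.push v).total f = e.total f + f (size v) := by
  simp [total, push, size, Request.tokens]

lemma level_push (T : ℕ) (f : ℕ → ℕ) (e : EngineState Z) (v : ℕ+ × ℕ+ × Z) :
    (e.push v).level b T f = e.level b T f + T * f (size v) := by
  simp only [level, total_push]
  simp only [push]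
  ring

lemma excess_push (ℓ : ℕ) (e : EngineState Z) (v : ℕ+ × ℕ+ × Z) :
    (e.push v).excess ℓ = e.excess ℓ + (size v - ℓ) := total_push _ _ _

lemma Valid.push {T : ℕ} {e : EngineState Z} (h : e.Valid T) (v : ℕ+ × ℕ+ × Z) :
    (e.push v).Valid T := by
  refine ⟨h.1, fun q hq => ?_⟩
  simp only [EngineState.push, List.mem_append, List.mem_singleton] at hq
  rcases hq with hq | rfl
  · exact h.2 q hq
  · exact v.2.1.ne_zero

lemma total_eq_sum (f : ℕ → ℕ) (e : EngineState Z) :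
    e.total f = ∑ i : Fin e.queue.length, f (e.queue.get i).tokens := by
  rw [← List.sum_ofFn]
  unfold total
  congr 1
  conv_lhs => rw [← List.ofFn_get e.queue, List.map_ofFn]
  rfl

end EngineState

/-- The number of tokens of the `i`-th request in the next batch. -/
def Scheduler.loaded (π : Scheduler Z b) (Q : List (Request Z)) (i : Fin Q.length) : ℕ :=
  π.δp Q i + π.δd Q i

lemma Scheduler.loaded_le (π : Scheduler Z b) {Q : List (Request Z)} (hQ : ∀ q ∈ Q, q.decode ≠ 0)
    (i : Fin Q.length) : π.loaded Q i ≤ (Q.get i).tokens := by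
  have h1 := π.prefill_le Q i
  have h2 := π.decode_le_one Q i
  have h3 := hQ _ (Q.get_mem i)
  unfold loaded Request.tokens
  omega

lemma Scheduler.total_loadBatch_le (π : Scheduler Z b) {Q : List (Request Z)}
    (hQ : ∀ q ∈ Q, q.decode ≠ 0) (f : ℕ → ℕ) (r : ℕ) :
    EngineState.total f ⟨r, π.loadBatch Q⟩
      ≤ ∑ i : Fin Q.length, f ((Q.get i).tokens - π.loaded Q i) := by
  unfold EngineState.total loadBatch
  refine (List.Sublist.sum_le_sum (List.filter_sublist.map _) (fun _ _ => Nat.zero_le _)).trans ?_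
  rw [List.map_ofFn, List.sum_ofFn]
  refine Finset.sum_le_sum fun i _ => le_of_eq ?_
  have h1 := π.prefill_le Q i
  have h2 := π.decode_le_one Q i
  have h3 := hQ _ (Q.get_mem i)
  simp only [Function.comp, Request.tokens, loaded]
  congr 1
  omega

lemma Scheduler.load_eq (π : Scheduler Z b) (Q : List (Request Z)) :
    π.load Q = ∑ i, π.loaded Q i := rfl

/-- A work-conserving batch is full, or it advances each of fewer than `b` requests. -/
lemma Scheduler.WorkConservingAt.full_or {π : Scheduler Z b} {Q : List (Request Z)}
    (h : π.WorkConservingAt Q) :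
    π.load Q = b ∨ (Q.length ≤ b ∧ ∀ i, 1 ≤ π.loaded Q i) := by
  rcases le_or_gt b (available Q) with hb | hb
  · left; rw [h, min_eq_left hb]
  · right
    have hload : π.load Q = available Q := by rw [h, min_eq_right hb.le]
    have hle : ∀ i ∈ Finset.univ, π.loaded Q i
        ≤ (Q.get i).prefill + if (Q.get i).prefill = 0 then 1 else 0 := by
      intro i _
      have h1 := π.prefill_le Q i
      have h2 := π.decode_le_one Q i
      have h3 := π.prefill_first Q i
      unfold loaded
      split_ifs <;> omega
    -- Termwise bounds whose sums agree are equalities, so no request is left out of a partial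
    -- batch.
    have heq := (Finset.sum_eq_sum_iff_of_le hle).1 hload
    have hone : ∀ i, 1 ≤ π.loaded Q i := by
      intro i
      rw [heq i (Finset.mem_univ i)]
      split_ifs <;> omega
    refine ⟨?_, hone⟩
    calc Q.length = ∑ _i : Fin Q.length, 1 := by simp
      _ ≤ ∑ i, π.loaded Q i := Finset.sum_le_sum fun i _ => hone i
      _ = available Q := hload
      _ ≤ b := hb.le

namespace EngineState

variable {t : ℕ → ℕ} {π : Scheduler Z b} {e : EngineState Z}

lemma serve_of_remaining_pos (hr : e.remaining ≠ 0) :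
    e.serve t π = ⟨e.remaining - 1, e.queue⟩ := by simp [serve, hr]

lemma serve_of_remaining_zero (hr : e.remaining = 0) :
    e.serve t π = ⟨t (π.load e.queue) - 1, π.loadBatch e.queue⟩ := by simp [serve, hr]

lemma Valid.serve (ht : Monotone t) (h : e.Valid (t b)) : (e.serve t π).Valid (t b) := by
  by_cases hr : e.remaining = 0
  · rw [serve_of_remaining_zero hr]
    have := ht (π.budget e.queue)
    refine ⟨(Nat.sub_le _ _).trans this, fun q hq => ?_⟩
    simpa using (List.mem_filter.1 hq).2
  · rw [serve_of_remaining_pos hr]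
    exact ⟨(Nat.sub_le _ _).trans h.1, h.2⟩

lemma level_serve_of_remaining_pos (hr : e.remaining ≠ 0) (T : ℕ) (f : ℕ → ℕ) :
    (e.serve t π).level b T f + b = e.level b T f := by
  rw [serve_of_remaining_pos hr]
  obtain ⟨r, hr'⟩ := Nat.exists_eq_succ_of_ne_zero hr
  simp only [level, total, hr', Nat.succ_sub_one, Nat.succ_eq_add_one]
  ring

lemma excess_serve_of_remaining_pos (hr : e.remaining ≠ 0) (ℓ : ℕ) :
    (e.serve t π).excess ℓ = e.excess ℓ := by
  rw [serve_of_remaining_pos hr]; rfl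

lemma excess_serve_le (h : e.Valid (t b)) (ℓ : ℕ) : (e.serve t π).excess ℓ ≤ e.excess ℓ := by
  by_cases hr : e.remaining = 0
  · rw [serve_of_remaining_zero hr]
    refine (π.total_loadBatch_le h.2 _ _).trans ?_
    rw [excess, total_eq_sum]
    exact Finset.sum_le_sum fun i _ => by omega
  · rw [excess_serve_of_remaining_pos hr]

lemma excess_serve_lt (h : e.Valid (t b)) (hr : e.remaining = 0) {ℓ : ℕ}
    (i : Fin e.queue.length) (hi : ℓ < (e.queue.get i).tokens) (hl : 1 ≤ π.loaded e.queue i) :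
    (e.serve t π).excess ℓ + 1 ≤ e.excess ℓ := by
  rw [serve_of_remaining_zero hr, Nat.succ_le_iff]
  refine (π.total_loadBatch_le h.2 _ _).trans_lt ?_
  rw [excess, total_eq_sum]
  exact Finset.sum_lt_sum (fun i _ => by omega) ⟨i, Finset.mem_univ i, by omega⟩

lemma exists_of_excess_ne_zero {ℓ : ℕ} (h : e.excess ℓ ≠ 0) :
    ∃ i : Fin e.queue.length, ℓ < (e.queue.get i).tokens := by
  by_contra! hcon
  apply h
  rw [excess, total_eq_sum]
  exact Finset.sum_eq_zero fun i _ => Nat.sub_eq_zero_of_le (hcon i)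

/-- A full batch lowers the level by `b`, up to the tokens that `f` does not count. -/
lemma level_serve_full (h : e.Valid (t b)) (ht : 1 ≤ t b) (hr : e.remaining = 0)
    (hfull : π.load e.queue = b) {f : ℕ → ℕ} {c : ℕ}
    (hf : ∑ i : Fin e.queue.length, f ((e.queue.get i).tokens - π.loaded e.queue i) + b
      ≤ e.total f + c) :
    (e.serve t π).level b (t b) f + b ≤ e.level b (t b) f + t b * c := by
  rw [serve_of_remaining_zero hr, hfull]
  have h1 := π.total_loadBatch_le h.2 f (t b - 1)
  -- The full batch removes `t b * b` from the token part and sets the clock part to `b * (t b -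
  -- 1)`; the net loss is `b`.
  obtain ⟨T, hT⟩ : ∃ T, t b = T + 1 := ⟨t b - 1, by omega⟩
  simp only [level, hr, hT, Nat.add_sub_cancel] at h1 ⊢
  have h2 := Nat.mul_le_mul_left (T + 1) ((Nat.add_le_add_right h1 b).trans hf)
  nlinarith

/-- Loading never raises the token part; only the clock of a new batch can raise the level. -/
lemma level_serve_le {f : ℕ → ℕ} (hf : Monotone f) (ht : Monotone t) (h : e.Valid (t b)) :
    (e.serve t π).level b (t b) f ≤ e.level b (t b) f + b * t b := by
  by_cases hr : e.remaining = 0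
  · have h1 := π.total_loadBatch_le h.2 f (t (π.load e.queue) - 1)
    have h2 : ∑ i : Fin e.queue.length, f ((e.queue.get i).tokens - π.loaded e.queue i)
        ≤ e.total f := by
      rw [total_eq_sum]
      exact Finset.sum_le_sum fun i _ => hf (Nat.sub_le _ _)
    have h3 : t (π.load e.queue) ≤ t b := ht (π.budget e.queue)
    rw [serve_of_remaining_zero hr]
    simp only [level, hr]
    gcongr
    · simp only [mul_zero, add_zero]
      exact Nat.mul_le_mul_left _ (h1.trans h2)
    · omega
  · have := level_serve_of_remaining_pos (t := t) (π := π) hr (t b) f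
    omega

/-- The effect of one slot of service on the level of a function `u` that, together with the
excess over `L`, counts every token. -/
lemma level_serve {u : ℕ → ℕ} {L : ℕ} (hu : Monotone u) (hu_le : ∀ w, u w ≤ w)
    (hu_exc : ∀ w' w, w' ≤ w → u w' + w + (w' - L) ≤ u w + w' + (w - L))
    (ht : Monotone t) (ht1 : 1 ≤ t b) (h : e.Valid (t b))
    (hwc : e.remaining = 0 → π.WorkConservingAt e.queue) :
    (e.serve t π).level b (t b) u + b
        ≤ e.level b (t b) u + t b * (e.excess L - (e.serve t π).excess L) ∨
      (e.serve t π).level b (t b) u ≤ e.level b (t b) u + b * t b ∧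
        ((e.serve t π).excess L + 1 ≤ e.excess L ∨ e.level b (t b) u ≤ t b * (b * L)) := by
  by_cases hr : e.remaining = 0
  swap
  · left
    rw [level_serve_of_remaining_pos hr]
    exact Nat.le_add_right _ _
  rcases (hwc hr).full_or with hfull | ⟨hlen, hone⟩
  · left
    refine level_serve_full h ht1 hr hfull ?_
    have h1 : (e.serve t π).excess L
        ≤ ∑ i : Fin e.queue.length, ((e.queue.get i).tokens - π.loaded e.queue i - L) := by
      rw [serve_of_remaining_zero hr]
      exact π.total_loadBatch_le h.2 _ _
    -- Every loaded token lowers `u` or the excess over `L`, which is what `hu_exc` says for each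
    -- request.
    have h2 : ∑ i : Fin e.queue.length,
        (u ((e.queue.get i).tokens - π.loaded e.queue i) + π.loaded e.queue i
          + ((e.queue.get i).tokens - π.loaded e.queue i - L))
        ≤ e.total u + e.excess L := by
      rw [excess, total_eq_sum, total_eq_sum, ← Finset.sum_add_distrib]
      refine Finset.sum_le_sum fun i _ => ?_
      have h3 := π.loaded_le h.2 i
      have h4 := hu_exc ((e.queue.get i).tokens - π.loaded e.queue i) _ (Nat.sub_le _ _)
      omega
    rw [Finset.sum_add_distrib, Finset.sum_add_distrib, ← Scheduler.load_eq, hfull] at h2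
    omega
  · right
    constructor
    · exact level_serve_le hu ht h
    -- Without excess there are at most `b` requests of at most `L` tokens each; with excess, a long
    -- request is among those that the partial batch advances.
    · by_cases hE : e.excess L = 0
      · right
        simp only [level, hr, mul_zero, add_zero]
        gcongr
        rw [total_eq_sum]
        rw [excess, total_eq_sum, Finset.sum_eq_zero_iff] at hE
        calc ∑ i : Fin e.queue.length, u (e.queue.get i).tokens
            ≤ ∑ _i : Fin e.queue.length, L := Finset.sum_le_sum fun i hi =>
              (hu_le _).trans (Nat.sub_eq_zero_iff_le.1 (hE i hi))
          _ = e.queue.length * L := by simp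
          _ ≤ b * L := by gcongr
      · left
        obtain ⟨i, hi⟩ := exists_of_excess_ne_zero hE
        exact excess_serve_lt h hr i hi (hone i)

/-- The tokens of the requests with at most `ℓ` tokens. -/
def small (ℓ w : ℕ) : ℕ := if w ≤ ℓ then w else 0

/-- In one slot of service, a request with more than `ℓ` tokens advances, or the other requests and
the current batch do. -/
lemma excess_or_level_serve {ℓ : ℕ} (ht1 : 1 ≤ t b) (h : e.Valid (t b))
    (hwc : e.remaining = 0 → π.WorkConservingAt e.queue) (hE : e.excess ℓ ≠ 0) :
    (e.serve t π).excess ℓ + 1 ≤ e.excess ℓ ∨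
      (e.serve t π).level b (t b) (small ℓ) + b ≤ e.level b (t b) (small ℓ) := by
  by_cases hr : e.remaining = 0
  swap
  · right
    rw [level_serve_of_remaining_pos hr]
  -- If no long request is loaded, the batch cannot be partial, so all its `b` tokens come from
  -- small requests.
  by_cases hex : ∃ i, ℓ < (e.queue.get i).tokens ∧ 1 ≤ π.loaded e.queue i
  · obtain ⟨i, hi, hl⟩ := hex
    exact Or.inl (excess_serve_lt h hr i hi hl)
  · right
    push Not at hex
    rcases (hwc hr).full_or with hfull | ⟨hlen, hone⟩
    · have h0 : ∑ i : Fin e.queue.length,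
          (small ℓ ((e.queue.get i).tokens - π.loaded e.queue i) + π.loaded e.queue i)
          ≤ e.total (small ℓ) := by
        rw [total_eq_sum]
        refine Finset.sum_le_sum fun i _ => ?_
        have h1 := π.loaded_le h.2 i
        have h2 := hex i
        unfold small
        split_ifs <;> omega
      rw [Finset.sum_add_distrib, ← Scheduler.load_eq, hfull] at h0
      simpa using level_serve_full h ht1 hr hfull (f := small ℓ) (c := 0) h0
    · obtain ⟨i, hi⟩ := exists_of_excess_ne_zero hE
      exact absurd (hone i) (hex i hi).not_ge

end EngineState

end LLMServing

/-! ### Slowly growing functions and the Lyapunov function of an engine. -/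

namespace LLMServing

variable {Z : Type*} {b K : ℕ}

/-- A nondecreasing function with values in `[0, 1]` that grows at most logarithmically. -/
structure SlowlyGrowing (g : ℕ → ℝ) : Prop where
  nonneg : ∀ n, 0 ≤ g n
  le_one : ∀ n, g n ≤ 1
  mono : Monotone g
  add_le : ∀ m n, g (m + n) ≤ g m + g n
  mul_le : ∀ m n, g (m * n) ≤ g m + g n

/-- A truncated logarithm. -/
def truncLog (η : ℝ) (n : ℕ) : ℝ := min 1 (η * Real.log (1 + n))

/-- Both `1 + (m + n)` and `1 + m * n` are at most `(1 + m) * (1 + n)`, whose logarithm splits;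
truncating nonnegative terms at 1 keeps the inequality. -/
lemma slowlyGrowing_truncLog {η : ℝ} (hη : 0 ≤ η) : SlowlyGrowing (truncLog η) := by
  have hnn : ∀ n : ℕ, 0 ≤ η * Real.log (1 + n) := fun n =>
    mul_nonneg hη (Real.log_nonneg (by simp))
  have hmono : ∀ m n : ℕ, ∀ x : ℕ, (x : ℝ) ≤ m + n + m * n →
      truncLog η x ≤ truncLog η m + truncLog η n := by
    intro m n x hx
    have h1 : Real.log (1 + x) ≤ Real.log (1 + m) + Real.log (1 + n) := by
      rw [← Real.log_mul (by positivity) (by positivity)]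
      exact Real.log_le_log (by positivity) (by nlinarith)
    have h2 : η * Real.log (1 + x) ≤ η * Real.log (1 + m) + η * Real.log (1 + n) := by
      rw [← mul_add]; exact mul_le_mul_of_nonneg_left h1 hη
    have := hnn m
    have := hnn n
    unfold truncLog
    rcases min_cases (1 : ℝ) (η * Real.log (1 + m)) with h | h <;>
    rcases min_cases (1 : ℝ) (η * Real.log (1 + n)) with h' | h' <;>
    rcases min_cases (1 : ℝ) (η * Real.log (1 + x)) with h'' | h'' <;> linarith
  refine ⟨fun n => le_min zero_le_one (hnn n), fun n => min_le_left _ _, fun m n hmn => ?_,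
    fun m n => hmono m n _ ?_, fun m n => hmono m n _ ?_⟩
  · unfold truncLog
    gcongr
  · push_cast
    have : (0 : ℝ) ≤ m * n := by positivity
    linarith
  · push_cast
    have : (0 : ℝ) ≤ (m : ℝ) + n := by positivity
    linarith

/-- The discrete primitive of `g`. -/
def primitive (g : ℕ → ℝ) (n : ℕ) : ℝ := ∑ i ∈ Finset.range n, g i

namespace SlowlyGrowing

variable {g : ℕ → ℝ}

lemma primitive_nonneg (hg : SlowlyGrowing g)
    (n : ℕ) : 0 ≤ primitive g n := Finset.sum_nonneg fun i _ => hg.nonneg i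

lemma primitive_mono (hg : SlowlyGrowing g) : Monotone (primitive g) := fun _ _ h =>
  Finset.sum_le_sum_of_subset_of_nonneg (Finset.range_mono h) fun i _ _ => hg.nonneg i

lemma primitive_add_le (hg : SlowlyGrowing g)
    (n h : ℕ) : primitive g (n + h) ≤ primitive g n + h * g (n + h) := by
  unfold primitive
  rw [Finset.sum_range_add]
  gcongr
  calc ∑ i ∈ Finset.range h, g (n + i) ≤ ∑ _i ∈ Finset.range h, g (n + h) :=
        Finset.sum_le_sum fun i hi => hg.mono (by have := Finset.mem_range.1 hi; omega)
    _ = h * g (n + h) := by simp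

lemma primitive_add_le' (hg : SlowlyGrowing g)
    (n h : ℕ) : primitive g (n + h) ≤ primitive g n + h :=
  (hg.primitive_add_le n h).trans (by
    have := hg.le_one (n + h)
    have h0 : (0 : ℝ) ≤ h := by positivity
    nlinarith)

/-- Each of the `b` removed summands is at least `g (n - b)`, which is within `g b` of `g n` by
subadditivity. The error `b * g b` also covers `n < b`. -/
lemma primitive_sub_add_le (hg : SlowlyGrowing g) (n b : ℕ) :
    primitive g (n - b) + b * g n ≤ primitive g n + b * g b := by
  rcases le_total b n with h | h
  · obtain ⟨k, rfl⟩ := Nat.exists_eq_add_of_le' h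
    rw [Nat.add_sub_cancel]
    have h1 : primitive g k + b * g k ≤ primitive g (k + b) := by
      unfold primitive
      rw [Finset.sum_range_add]
      gcongr
      calc (b : ℝ) * g k = ∑ _i ∈ Finset.range b, g k := by simp
        _ ≤ ∑ i ∈ Finset.range b, g (k + i) :=
            Finset.sum_le_sum fun i _ => hg.mono (by omega)
    have h2 := hg.add_le k b
    have h0 : (0 : ℝ) ≤ b := by positivity
    nlinarith
  · have h1 := hg.mono h
    have h2 := hg.primitive_nonneg n
    have h0 : (0 : ℝ) ≤ b := by positivity
    rw [Nat.sub_eq_zero_of_le h]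
    have : primitive g 0 = 0 := by simp [primitive]
    nlinarith

end SlowlyGrowing

/-- A function `u` of the token number of a request which, together with the excess over `L`,
counts all tokens. -/
structure Counting (u : ℕ → ℕ) (L : ℕ) : Prop where
  mono : Monotone u
  le_self : ∀ w, u w ≤ w
  pos : ∀ w, 1 ≤ w → 1 ≤ u w
  excess : ∀ w' w, w' ≤ w → u w' + w + (w' - L) ≤ u w + w' + (w - L)

lemma counting_id (L : ℕ) : Counting (fun w => w) L :=
  ⟨monotone_id, fun _ => le_rfl, fun _ h => h, fun w' w h => by omega⟩

lemma counting_min {L : ℕ} (hL : 1 ≤ L) : Counting (fun w => min w L) L :=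
  ⟨fun _ _ h => min_le_min_right _ h, fun _ => min_le_left _ _, fun _ h => le_min h hL,
    fun w' w h => by omega⟩

namespace EngineState

variable {t : ℕ → ℕ} {π : Scheduler Z b} {e : EngineState Z}

/-- The Lyapunov function of an engine. -/
def lyapunov (g : ℕ → ℝ) (u : ℕ → ℕ) (L b T : ℕ) (e : EngineState Z) : ℝ :=
  primitive g (e.level b T u) + (b * T + b + T : ℕ) * (e.excess L : ℝ)

variable {g : ℕ → ℝ} {u : ℕ → ℕ} {L : ℕ}

lemma lyapunov_nonneg (hg : SlowlyGrowing g) (T : ℕ) : 0 ≤ e.lyapunov g u L b T :=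
  add_nonneg (hg.primitive_nonneg _) (by positivity)

/-- The three cases follow `level_serve`. The coefficient `b * T + b + T` of the excess pays for the
uncounted tokens of a full batch (`T` each) and for a partial batch that advances a long request (`b
* T + b`); in the remaining case the level is bounded and `g` is small there. -/
lemma lyapunov_serve (hg : SlowlyGrowing g)
    (hu : Counting u L) (ht : Monotone t) (ht1 : 1 ≤ t b) (h : e.Valid (t b))
    (hwc : e.remaining = 0 → π.WorkConservingAt e.queue) :
    (e.serve t π).lyapunov g u L b (t b) + b * g (e.level b (t b) u)
      ≤ e.lyapunov g u L b (t b) + (b + b * t b) * g (b + t b * (b * L) + b * t b) := by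
  have hE := excess_serve_le (t := t) (π := π) h L
  have key := level_serve hu.mono hu.le_self hu.excess ht ht1 h hwc
  unfold lyapunov
  generalize hX' : (e.serve t π).level b (t b) u = X' at *
  generalize hX : e.level b (t b) u = X at *
  generalize hE1 : (e.serve t π).excess L = E' at *
  generalize hE2 : e.excess L = E at *
  -- One argument of `g` that dominates `b`, the low levels, and the low levels raised by a new
  -- batch.
  set c₁ := b + t b * (b * L) + b * t b with hc₁
  have hgc := hg.nonneg c₁
  have hb0 : (0 : ℝ) ≤ b := by positivity
  have hT0 : (0 : ℝ) ≤ t b := by positivity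
  have hbT0 : (0 : ℝ) ≤ b * t b := by positivity
  obtain ⟨d, rfl⟩ := Nat.exists_eq_add_of_le hE
  push_cast
  rcases key with h1 | ⟨h1, h2 | h2⟩
  · rw [Nat.add_sub_cancel_left] at h1
    have h3 : X' ≤ (X - b) + t b * d := by omega
    have h4 := (hg.primitive_mono h3).trans (hg.primitive_add_le' _ _)
    have h5 := hg.primitive_sub_add_le X b
    have h6 : g b ≤ g c₁ := hg.mono (by omega)
    push_cast at h4
    have h7 : (b : ℝ) * g b ≤ b * g c₁ := mul_le_mul_of_nonneg_left h6 hb0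
    have h8 : 0 ≤ (b * t b : ℝ) * g c₁ := by positivity
    have h9 : 0 ≤ (b * t b + b : ℝ) * d := by positivity
    nlinarith
  · have h3 := (hg.primitive_mono h1).trans (hg.primitive_add_le' _ _)
    push_cast at h3
    have h4 : (1 : ℝ) ≤ d := by exact_mod_cast (by omega : 1 ≤ d)
    have h5 : (b : ℝ) * g X ≤ b := mul_le_of_le_one_right hb0 (hg.le_one X)
    have h8 : 0 ≤ (b + b * t b : ℝ) * g c₁ := by positivity
    have h9 : 0 ≤ (b * t b + b + t b : ℝ) * (d - 1) := mul_nonneg (by positivity) (by linarith)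
    nlinarith
  · have h3 := (hg.primitive_mono h1).trans (hg.primitive_add_le _ _)
    push_cast at h3
    have h4 : g (X + b * t b) ≤ g c₁ := hg.mono (by omega)
    have h5 : g X ≤ g c₁ := hg.mono (by omega)
    have h6 : (b * t b : ℝ) * g (X + b * t b) ≤ b * t b * g c₁ :=
      mul_le_mul_of_nonneg_left h4 hbT0
    have h7 : (b : ℝ) * g X ≤ b * g c₁ := mul_le_mul_of_nonneg_left h5 hb0
    have h9 : 0 ≤ (b * t b + b + t b : ℝ) * d := by positivity
    nlinarith

lemma g_level_serve_le (hg : SlowlyGrowing g)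
    (hu : Monotone u) (ht : Monotone t) (h : e.Valid (t b)) :
    g ((e.serve t π).level b (t b) u) ≤ g (e.level b (t b) u) + g (b * t b) :=
  (hg.mono (level_serve_le hu ht h)).trans (hg.add_le _ _)

/-- The slope of the primitive is at most `g` at the new level, which subadditivity separates into
the old level and a term depending only on the request. -/
lemma lyapunov_push (hg : SlowlyGrowing g) (hu : Counting u L) (T : ℕ) (v : ℕ+ × ℕ+ × Z) :
    (e.push v).lyapunov g u L b T ≤ e.lyapunov g u L b T
      + T * size v * (g (e.level b T u) + g (T * size v))
      + (b * T + b + T : ℕ) * ((size v - L : ℕ) : ℝ) := by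
  unfold lyapunov
  rw [level_push, excess_push]
  have h1 := hg.primitive_add_le (e.level b T u) (T * u (size v))
  have h2 : g (e.level b T u + T * u (size v)) ≤ g (e.level b T u) + g (T * size v) :=
    (hg.add_le _ _).trans (by
      gcongr
      exact hg.mono (Nat.mul_le_mul_left _ (hu.le_self _)))
  have h3 : ((T * u (size v) : ℕ) : ℝ) ≤ T * size v := by
    exact_mod_cast Nat.mul_le_mul_left _ (hu.le_self _)
  have h4 := mul_le_mul h3 h2 (hg.nonneg _) (by positivity)
  push_cast at h1 h4 ⊢
  nlinarith

end EngineState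

end LLMServing

/-! ### Arrivals, routing and the drift of the system Lyapunov function. -/

namespace LLMServing

open MarkovChain

variable {Z : Type*} {b K : ℕ}

/-- The state after a request with data `v` has joined engine `k`. -/
abbrev arrive (s : SystemState K Z) (v : ℕ+ × ℕ+ × Z) (k : Fin K) : SystemState K Z :=
  Function.update s k ((s k).push v)

lemma sum_update_le {s : SystemState K Z} {k : Fin K} {e : EngineState Z} {f : EngineState Z → ℝ}
    {x : ℝ} (h : f e ≤ f (s k) + x) :
    ∑ j, f (Function.update s k e j) ≤ ∑ j, f (s j) + x := by
  rw [← Finset.add_sum_erase _ _ (Finset.mem_univ k),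
    ← Finset.add_sum_erase (Finset.univ) (fun j => f (s j)) (Finset.mem_univ k)]
  have : ∑ j ∈ Finset.univ.erase k, f (Function.update s k e j)
      = ∑ j ∈ Finset.univ.erase k, f (s j) :=
    Finset.sum_congr rfl fun j hj => by rw [Function.update_of_ne (Finset.ne_of_mem_erase hj)]
  rw [this, Function.update_self]
  linarith

/-- All engines are in a valid state. -/
def ValidState (T : ℕ) (s : SystemState K Z) : Prop := ∀ k, (s k).Valid T

lemma ValidState.arrive {T : ℕ} {s : SystemState K Z} (h : ValidState T s) (v : ℕ+ × ℕ+ × Z)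
    (k : Fin K) : ValidState T (arrive s v k) := by
  intro j
  by_cases hj : j = k
  · subst hj
    simpa using (h j).push v
  · simpa [hj] using h j

/-- The effect of `n` arrivals on a function whose mean increment by one arrival is controlled by
a slowly varying function `A ≤ 1`. -/
lemma expect_addArrivals_le {ν : PMF (ℕ+ × ℕ+ × Z)} {ρ : Router K Z} {T : ℕ}
    {V A : SystemState K Z → ℝ≥0∞} {a : ℕ+ × ℕ+ × Z → ℝ≥0∞} {c d γ : ℝ≥0∞}
    (hV : ∀ s, ValidState T s →
      expect ν (fun v => expect (ρ s) fun k => V (arrive s v k)) ≤ V s + (c * A s + d))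
    (hA1 : ∀ s, A s ≤ 1)
    (hA : ∀ s v k, A (arrive s v k) ≤ A s + a v) (hγ : expect ν a ≤ γ) (n : ℕ)
    (s : SystemState K Z) (hs : ValidState T s) :
    expect (addArrivals ν ρ n s) V ≤ V s + n * (c * min 1 (A s + n * γ) + d) := by
  induction n generalizing s with
  | zero => simp [addArrivals, expect_pure]
  | succ n ih =>
    rw [addArrivals, expect_bind]
    simp only [expect_bind]
    -- Earlier arrivals of the slot shift `A` by `γ` each in the mean. The truncation at 1 is
    -- carried along, since the bound is multiplied by the number of arrivals.
    have hmin : expect ν (fun v => min 1 (A s + a v + n * γ)) ≤ min 1 (A s + (n + 1 : ℕ) * γ) := by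
      refine le_min ?_ ?_
      · exact (expect_mono fun v => min_le_left _ _).trans (expect_const _ _).le
      · refine (expect_mono fun v => min_le_right _ _).trans ?_
        simp only [expect_add, expect_const]
        push_cast
        calc A s + expect ν a + n * γ ≤ A s + γ + n * γ := by gcongr
          _ = A s + (n + 1) * γ := by ring
    calc expect ν (fun v => expect (ρ s) fun k => expect (addArrivals ν ρ n (arrive s v k)) V)
        ≤ expect ν (fun v => expect (ρ s) fun k => V (arrive s v k)
            + n * (c * min 1 (A s + a v + n * γ) + d)) := by
          refine expect_mono fun v => expect_mono fun k => (ih _ (hs.arrive v k)).trans ?_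
          gcongr
          exact hA s v k
      _ = expect ν (fun v => expect (ρ s) fun k => V (arrive s v k))
            + n * (c * expect ν (fun v => min 1 (A s + a v + n * γ)) + d) := by
          simp only [expect_add, expect_const, expect_const_mul]
      _ ≤ (V s + (c * A s + d)) + n * (c * min 1 (A s + (n + 1 : ℕ) * γ) + d) := by
          gcongr
          exact hV s hs
      _ ≤ (V s + (c * min 1 (A s + (n + 1 : ℕ) * γ) + d))
            + n * (c * min 1 (A s + (n + 1 : ℕ) * γ) + d) := by
          gcongr
          exact le_min (hA1 s) le_self_add
      _ = V s + (n + 1 : ℕ) * (c * min 1 (A s + (n + 1 : ℕ) * γ) + d) := by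
          push_cast; ring

/-- The sum over the engines of their Lyapunov functions. -/
def systemLyapunov (g : ℕ → ℝ) (u : ℕ → ℕ) (L b T : ℕ) (s : SystemState K Z) : ℝ :=
  ∑ k, (s k).lyapunov g u L b T

/-- The average over the engines of `g` at their levels. -/
def average (g : ℕ → ℝ) (u : ℕ → ℕ) (b T : ℕ) (s : SystemState K Z) : ℝ :=
  (∑ k, g ((s k).level b T u)) / K

/-- The router sends requests to engines where `g` of the level is at most average, up to `η`. -/
def Router.Balances (ρ : Router K Z) (g : ℕ → ℝ) (u : ℕ → ℕ) (b T : ℕ) (η : ℝ≥0∞) : Prop :=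
  ∀ s, ValidState T s → expect (ρ s) (fun k => ENNReal.ofReal (g ((s k).level b T u)))
    ≤ ENNReal.ofReal (average g u b T s) + η

section drift

variable {g : ℕ → ℝ} {u : ℕ → ℕ} {L : ℕ}

lemma average_nonneg (hg : SlowlyGrowing g) (T : ℕ) (s : SystemState K Z) : 0 ≤ average g u b T s :=
  div_nonneg (Finset.sum_nonneg fun _ _ => hg.nonneg _) (by positivity)

lemma average_le_one (hg : SlowlyGrowing g)
    (T : ℕ) (s : SystemState K Z) : average g u b T s ≤ 1 := by
  refine div_le_one_of_le₀ ?_ (by positivity)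
  calc ∑ k, g ((s k).level b T u) ≤ ∑ _k : Fin K, (1 : ℝ) :=
        Finset.sum_le_sum fun _ _ => hg.le_one _
    _ = K := by simp

lemma average_arrive (hg : SlowlyGrowing g)
    [NeZero K] (hu : Counting u L) (T : ℕ) (s : SystemState K Z)
    (v : ℕ+ × ℕ+ × Z) (k : Fin K) :
    average g u b T (arrive s v k) ≤ average g u b T s + g (T * size v) := by
  have hK : (1 : ℝ) ≤ K := by exact_mod_cast NeZero.one_le
  have h1 : g (((s k).push v).level b T u) ≤ g ((s k).level b T u) + g (T * size v) := by
    rw [EngineState.level_push]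
    refine (hg.add_le _ _).trans ?_
    gcongr
    exact hg.mono (Nat.mul_le_mul_left _ (hu.le_self _))
  have h2 := sum_update_le (f := fun e => g (e.level b T u)) h1
  unfold average
  rw [div_le_iff₀ (by linarith), add_mul, div_mul_cancel₀ _ (by linarith)]
  refine h2.trans ?_
  have := hg.nonneg (T * size v)
  nlinarith

lemma systemLyapunov_nonneg (hg : SlowlyGrowing g)
    (T : ℕ) (s : SystemState K Z) : 0 ≤ systemLyapunov g u L b T s :=
  Finset.sum_nonneg fun _ _ => EngineState.lyapunov_nonneg hg T

lemma systemLyapunov_arrive (hg : SlowlyGrowing g)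
    (hu : Counting u L) (T : ℕ) (s : SystemState K Z) (v : ℕ+ × ℕ+ × Z)
    (k : Fin K) :
    ENNReal.ofReal (systemLyapunov g u L b T (arrive s v k))
      ≤ ENNReal.ofReal (systemLyapunov g u L b T s)
        + T * (size v * ENNReal.ofReal (g ((s k).level b T u))
            + size v * ENNReal.ofReal (g (T * size v)))
        + (b * T + b + T : ℕ) * ((size v - L : ℕ) : ℝ≥0∞) := by
  have h1 := EngineState.lyapunov_push (b := b) (e := s k) hg hu T v
  rw [add_assoc] at h1
  have h2 := ENNReal.ofReal_le_ofReal
    (sum_update_le (f := fun e => e.lyapunov g u L b T) h1)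
  refine h2.trans (le_of_eq ?_)
  have hx := hg.nonneg ((s k).level b T u)
  have hy := hg.nonneg (T * size v)
  have hF := systemLyapunov_nonneg (b := b) (L := L) (u := u) hg T s
  unfold systemLyapunov at hF ⊢
  rw [ENNReal.ofReal_add hF (by positivity), ENNReal.ofReal_add (by positivity) (by positivity),
    ENNReal.ofReal_mul (by positivity), ENNReal.ofReal_mul (by positivity),
    ENNReal.ofReal_mul (by positivity), ENNReal.ofReal_add hx hy]
  simp only [ENNReal.ofReal_natCast]
  ring

lemma expect_systemLyapunov_arrive (hg : SlowlyGrowing g)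
    {ν : PMF (ℕ+ × ℕ+ × Z)} {ρ : Router K Z} {T : ℕ} {η : ℝ≥0∞}
    (hρ : ρ.Balances g u b T η) (hu : Counting u L) (s : SystemState K Z) (hs : ValidState T s) :
    expect ν (fun v => expect (ρ s) fun k =>
        ENNReal.ofReal (systemLyapunov g u L b T (arrive s v k)))
      ≤ ENNReal.ofReal (systemLyapunov g u L b T s)
        + (T * expect ν (fun v => (size v : ℝ≥0∞)) * ENNReal.ofReal (average g u b T s)
          + (T * expect ν (fun v => (size v : ℝ≥0∞)) * η
            + T * expect ν (fun v => size v * ENNReal.ofReal (g (T * size v)))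
            + (b * T + b + T : ℕ) * expect ν fun v => ((size v - L : ℕ) : ℝ≥0∞))) := by
  calc _ ≤ expect ν (fun v => expect (ρ s) fun k =>
        ENNReal.ofReal (systemLyapunov g u L b T s)
        + T * (size v * ENNReal.ofReal (g ((s k).level b T u))
            + size v * ENNReal.ofReal (g (T * size v)))
        + (b * T + b + T : ℕ) * ((size v - L : ℕ) : ℝ≥0∞)) :=
        expect_mono fun v => expect_mono fun k => systemLyapunov_arrive hg hu T s v k
    _ = ENNReal.ofReal (systemLyapunov g u L b T s)
        + T * (expect ν (fun v => (size v : ℝ≥0∞))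
            * expect (ρ s) (fun k => ENNReal.ofReal (g ((s k).level b T u)))
            + expect ν (fun v => size v * ENNReal.ofReal (g (T * size v))))
        + (b * T + b + T : ℕ) * expect ν fun v => ((size v - L : ℕ) : ℝ≥0∞) := by
        simp only [expect_add, expect_const, expect_const_mul, expect_mul_const]
    _ ≤ ENNReal.ofReal (systemLyapunov g u L b T s)
        + T * (expect ν (fun v => (size v : ℝ≥0∞))
            * (ENNReal.ofReal (average g u b T s) + η)
            + expect ν (fun v => size v * ENNReal.ofReal (g (T * size v))))
        + (b * T + b + T : ℕ) * expect ν fun v => ((size v - L : ℕ) : ℝ≥0∞) := by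
        gcongr
        exact hρ s hs
    _ = _ := by ring

/-- The drift of the system Lyapunov function in one slot. -/
lemma expect_step_systemLyapunov (hg : SlowlyGrowing g)
    [NeZero K] {t : ℕ → ℕ} {α : PMF ℕ} {ν : PMF (ℕ+ × ℕ+ × Z)}
    {π : Scheduler Z b} {ρ : Router K Z} {η : ℝ≥0∞} (hρ : ρ.Balances g u b (t b) η)
    (hu : Counting u L) (ht : Monotone t) (ht1 : 1 ≤ t b) {s : SystemState K Z}
    (hs : ValidState (t b) s) (hwc : ∀ k, (s k).remaining = 0 → π.WorkConservingAt (s k).queue)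
    {m Λ γ : ℝ≥0∞} (hm : m = expect ν fun v => (size v : ℝ≥0∞))
    (hΛ : Λ = expect α fun n => (n : ℝ≥0∞))
    (hγ : γ = expect ν fun v => ENNReal.ofReal (g (t b * size v))) :
    expect (step t α ν π ρ s) (fun s' => ENNReal.ofReal (systemLyapunov g u L b (t b) s'))
        + (K * b : ℕ) * ENNReal.ofReal (average g u b (t b) s)
      ≤ ENNReal.ofReal (systemLyapunov g u L b (t b) s)
        + t b * m * Λ * ENNReal.ofReal (average g u b (t b) s)
        + (K * (b + b * t b) : ℕ) * ENNReal.ofReal (g (b + t b * (b * L) + b * t b))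
        + t b * m * Λ * ENNReal.ofReal (g (b * t b))
        + t b * m * expect α (fun n => n * min 1 (n * γ))
        + Λ * (t b * m * η + t b * expect ν (fun v => size v * ENNReal.ofReal (g (t b * size v)))
            + (b * t b + b + t b : ℕ) * expect ν fun v => ((size v - L : ℕ) : ℝ≥0∞)) := by
  set s₁ : SystemState K Z := fun k => (s k).serve t π with hs₁
  have hK : (0 : ℝ) < K := by exact_mod_cast NeZero.pos K
  set d : ℝ≥0∞ := t b * m * η
    + t b * expect ν (fun v => size v * ENNReal.ofReal (g (t b * size v)))
    + (b * t b + b + t b : ℕ) * expect ν fun v => ((size v - L : ℕ) : ℝ≥0∞) with hd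
  have hs₁v : ValidState (t b) s₁ := fun k => (hs k).serve ht
  have harr : ∀ n, expect (addArrivals ν ρ n s₁)
      (fun s' => ENNReal.ofReal (systemLyapunov g u L b (t b) s'))
      ≤ ENNReal.ofReal (systemLyapunov g u L b (t b) s₁)
        + n * (t b * m * min 1 (ENNReal.ofReal (average g u b (t b) s₁) + n * γ) + d) := by
    intro n
    refine expect_addArrivals_le (T := t b) (A := fun s => ENNReal.ofReal (average g u b (t b) s))
      (a := fun v => ENNReal.ofReal (g (t b * size v))) ?_ ?_ ?_ hγ.ge n s₁ hs₁v
    · intro s hs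
      rw [hd, hm]
      exact expect_systemLyapunov_arrive hg hρ hu s hs
    · intro s
      exact ENNReal.ofReal_le_one.2 (average_le_one hg _ _)
    · intro s v k
      rw [← ENNReal.ofReal_add (average_nonneg hg _ _) (hg.nonneg _)]
      exact ENNReal.ofReal_le_ofReal (average_arrive hg hu _ s v k)
  have hstep : expect (step t α ν π ρ s)
      (fun s' => ENNReal.ofReal (systemLyapunov g u L b (t b) s'))
      ≤ ENNReal.ofReal (systemLyapunov g u L b (t b) s₁)
        + (t b * m * (Λ * ENNReal.ofReal (average g u b (t b) s₁)
            + expect α (fun n => n * min 1 (n * γ))) + Λ * d) := by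
    unfold step
    rw [expect_bind]
    calc _ ≤ expect α (fun n => ENNReal.ofReal (systemLyapunov g u L b (t b) s₁)
          + (t b * m * (n * ENNReal.ofReal (average g u b (t b) s₁) + n * min 1 (n * γ))
            + n * d)) := by
          refine expect_mono fun n => (harr n).trans ?_
          -- The truncation is moved to the arrival part: `n * min 1 (n * γ)` is dominated by `n`,
          -- so no second moment of `α` is needed.
          have h1 : min 1 (ENNReal.ofReal (average g u b (t b) s₁) + n * γ)
              ≤ ENNReal.ofReal (average g u b (t b) s₁) + min 1 (n * γ) := by
            rcases le_total 1 (n * γ) with h | h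
            · rw [min_eq_left h]
              exact (min_le_left _ _).trans le_add_self
            · rw [min_eq_right h]
              exact min_le_right _ _
          calc _ ≤ ENNReal.ofReal (systemLyapunov g u L b (t b) s₁) + n * (t b * m *
                (ENNReal.ofReal (average g u b (t b) s₁) + min 1 (n * γ)) + d) := by gcongr
            _ = _ := by ring
      _ = _ := by
          simp only [expect_add, expect_const, expect_const_mul, expect_mul_const, ← hΛ]
  have hserve : systemLyapunov g u L b (t b) s₁ + (K * b : ℕ) * average g u b (t b) s
      ≤ systemLyapunov g u L b (t b) s
        + (K * (b + b * t b) : ℕ) * g (b + t b * (b * L) + b * t b) := by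
    have h1 : ((K * b : ℕ) : ℝ) * average g u b (t b) s = ∑ k, b * g ((s k).level b (t b) u) := by
      unfold average
      rw [← Finset.mul_sum]
      push_cast
      field_simp
    rw [h1]
    unfold systemLyapunov
    rw [← Finset.sum_add_distrib]
    calc _ ≤ ∑ k, ((s k).lyapunov g u L b (t b)
          + (b + b * t b) * g (b + t b * (b * L) + b * t b)) :=
          Finset.sum_le_sum fun k _ => EngineState.lyapunov_serve hg hu ht ht1 (hs k) (hwc k)
      _ = _ := by
          rw [Finset.sum_add_distrib]
          simp
          ring
  have hserve' := ENNReal.ofReal_le_ofReal hserve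
  rw [ENNReal.ofReal_add (systemLyapunov_nonneg hg _ _)
      (mul_nonneg (by positivity) (average_nonneg hg _ _)),
    ENNReal.ofReal_add (systemLyapunov_nonneg hg _ _)
      (mul_nonneg (by positivity) (hg.nonneg _)),
    ENNReal.ofReal_mul (by positivity), ENNReal.ofReal_mul (by positivity),
    ENNReal.ofReal_natCast, ENNReal.ofReal_natCast] at hserve'
  have havg : ENNReal.ofReal (average g u b (t b) s₁)
      ≤ ENNReal.ofReal (average g u b (t b) s) + ENNReal.ofReal (g (b * t b)) := by
    rw [← ENNReal.ofReal_add (average_nonneg hg _ _) (hg.nonneg _)]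
    refine ENNReal.ofReal_le_ofReal ?_
    unfold average
    rw [div_le_iff₀ hK, add_mul, div_mul_cancel₀ _ hK.ne']
    calc _ ≤ ∑ k, (g ((s k).level b (t b) u) + g (b * t b)) :=
          Finset.sum_le_sum fun k _ => EngineState.g_level_serve_le hg hu.mono ht (hs k)
      _ = _ := by rw [Finset.sum_add_distrib]; simp; ring
  calc _ ≤ ENNReal.ofReal (systemLyapunov g u L b (t b) s₁)
        + (t b * m * (Λ * ENNReal.ofReal (average g u b (t b) s₁)
            + expect α (fun n => n * min 1 (n * γ))) + Λ * d)
        + (K * b : ℕ) * ENNReal.ofReal (average g u b (t b) s) := by gcongr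
    _ = (ENNReal.ofReal (systemLyapunov g u L b (t b) s₁)
        + (K * b : ℕ) * ENNReal.ofReal (average g u b (t b) s))
        + (t b * m * (Λ * ENNReal.ofReal (average g u b (t b) s₁)
            + expect α (fun n => n * min 1 (n * γ))) + Λ * d) := by ring
    _ ≤ (ENNReal.ofReal (systemLyapunov g u L b (t b) s)
        + (K * (b + b * t b) : ℕ) * ENNReal.ofReal (g (b + t b * (b * L) + b * t b)))
        + (t b * m * (Λ * (ENNReal.ofReal (average g u b (t b) s) + ENNReal.ofReal (g (b * t b)))
            + expect α (fun n => n * min 1 (n * γ))) + Λ * d) := by gcongr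
    _ = _ := by ring

end drift

end LLMServing

/-! ### Progress of requests with many tokens. -/

namespace LLMServing

open MarkovChain

variable {Z : Type*} {b K : ℕ}

namespace EngineState

/-- Zero if no request has more than `ℓ` tokens, and otherwise exponentially small in the number
of tokens of the other requests. -/
def bonus (θ : ℝ) (ℓ b T : ℕ) (e : EngineState Z) : ℝ :=
  if e.excess ℓ = 0 then 0 else θ ^ e.level b T (small ℓ)

/-- An affine function of the excess over `ℓ`, cut off at zero. -/
def giantBound (ℓ : ℕ) (e : EngineState Z) : ℕ := if e.excess ℓ = 0 then 0 else 2 * e.excess ℓ + 1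

/-- A Lyapunov function for the requests with more than `ℓ` tokens. -/
def giantLyapunov (θ : ℝ) (ℓ b T : ℕ) (e : EngineState Z) : ℝ :=
  e.giantBound ℓ - e.bonus θ ℓ b T

variable {t : ℕ → ℕ} {π : Scheduler Z b} {e : EngineState Z} {θ : ℝ} {ℓ : ℕ}

lemma bonus_nonneg (hθ : 0 ≤ θ) (T : ℕ) : 0 ≤ e.bonus θ ℓ b T := by
  unfold bonus; split_ifs <;> positivity

lemma giantLyapunov_nonneg (hθ : 0 ≤ θ) (hθ1 : θ ≤ 1) (T : ℕ) :
    0 ≤ e.giantLyapunov θ ℓ b T := by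
  unfold giantLyapunov bonus giantBound
  split_ifs
  · simp
  · have := pow_le_one₀ hθ hθ1 (n := e.level b T (small ℓ))
    push_cast
    have : (0 : ℝ) ≤ e.excess ℓ := by positivity
    linarith

lemma giantBound_push_le (v : ℕ+ × ℕ+ × Z) :
    ((e.push v).giantBound ℓ : ℝ) ≤ e.giantBound ℓ + 3 * (size v - ℓ : ℕ) := by
  have : (e.push v).giantBound ℓ ≤ e.giantBound ℓ + 3 * (size v - ℓ) := by
    unfold giantBound
    rw [excess_push]
    split_ifs <;> omega
  exact_mod_cast this

/-- If the excess drops, `giantBound` falls by at least 2, enough for two bonuses of at most 1.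
Otherwise the small level drops by at least 1, and the old bonus is at most `θ` times the new one;
then `2 * θ ≤ p` suffices. The factor `p` is the probability that no arrival spoils the new bonus.
-/
lemma giantBound_serve_add_bonus_le {p : ℝ} (hp : 0 ≤ p) (hθ : 0 ≤ θ) (hθ1 : θ ≤ 1)
    (hθp : 2 * θ ≤ p) (hb : 1 ≤ b) (ht1 : 1 ≤ t b) (h : e.Valid (t b))
    (hwc : e.remaining = 0 → π.WorkConservingAt e.queue) :
    ((e.serve t π).giantBound ℓ : ℝ) + e.bonus θ ℓ b (t b)
      ≤ e.giantLyapunov θ ℓ b (t b) + p * (e.serve t π).bonus θ ℓ b (t b) := by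
  have hle := excess_serve_le (t := t) (π := π) h ℓ
  have hbon := mul_nonneg hp ((e.serve t π).bonus_nonneg (b := b) (ℓ := ℓ) hθ (t b))
  by_cases hE : e.excess ℓ = 0
  · have hE' : (e.serve t π).excess ℓ = 0 := by omega
    simp [giantLyapunov, giantBound, bonus, hE, hE']
  · have hpow := pow_le_one₀ hθ hθ1 (n := e.level b (t b) (small ℓ))
    have hbonus : e.bonus θ ℓ b (t b) = θ ^ e.level b (t b) (small ℓ) := by simp [bonus, hE]
    have hbd : (e.giantBound ℓ : ℝ) = 2 * e.excess ℓ + 1 := by simp [giantBound, hE]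
    by_cases hlt : (e.serve t π).excess ℓ + 1 ≤ e.excess ℓ
    · have h1 : ((e.serve t π).giantBound ℓ : ℝ) + 1 ≤ 2 * e.excess ℓ := by
        have : (e.serve t π).giantBound ℓ + 1 ≤ 2 * e.excess ℓ := by
          unfold giantBound; split_ifs <;> omega
        exact_mod_cast this
      unfold giantLyapunov
      rw [hbd, hbonus]
      linarith
    · have hlev := (excess_or_level_serve ht1 h hwc hE).resolve_left hlt
      have heq : (e.serve t π).excess ℓ = e.excess ℓ := by omega
      have hb1 : ((e.serve t π).giantBound ℓ : ℝ) = e.giantBound ℓ := by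
        simp [giantBound, heq]
      have hb2 : (e.serve t π).bonus θ ℓ b (t b)
          = θ ^ (e.serve t π).level b (t b) (small ℓ) := by simp [bonus, heq, hE]
      have h1 : θ ^ e.level b (t b) (small ℓ)
          ≤ θ ^ ((e.serve t π).level b (t b) (small ℓ) + 1) :=
        pow_le_pow_of_le_one hθ hθ1 (by omega)
      have h2 := pow_nonneg hθ ((e.serve t π).level b (t b) (small ℓ))
      unfold giantLyapunov
      rw [hb1, hb2, hbonus]
      rw [pow_succ] at h1
      nlinarith

end EngineState

/-- The drift of the Lyapunov function for the requests with more than `ℓ` tokens. -/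
lemma expect_step_giantLyapunov {t : ℕ → ℕ} {α : PMF ℕ} {ν : PMF (ℕ+ × ℕ+ × Z)}
    {π : Scheduler Z b} {ρ : Router K Z} (hb : 1 ≤ b) (ht : Monotone t) (ht1 : 1 ≤ t b)
    {s : SystemState K Z} (hs : ValidState (t b) s)
    (hwc : ∀ k, (s k).remaining = 0 → π.WorkConservingAt (s k).queue) {θ : ℝ}
    (hθ : θ = (α 0).toReal / 2) (ℓ : ℕ) :
    expect (step t α ν π ρ s)
        (fun s' => ENNReal.ofReal (∑ k, (s' k).giantLyapunov θ ℓ b (t b)))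
        + ENNReal.ofReal (∑ k, (s k).bonus θ ℓ b (t b))
      ≤ ENNReal.ofReal (∑ k, (s k).giantLyapunov θ ℓ b (t b))
        + expect α (fun n => (n : ℝ≥0∞)) * (3 * expect ν fun v => ((size v - ℓ : ℕ) : ℝ≥0∞)) := by
  have hp0 : 0 ≤ (α 0).toReal := ENNReal.toReal_nonneg
  have hp1 : (α 0).toReal ≤ 1 := ENNReal.toReal_le_of_le_ofReal zero_le_one
    (by simpa using PMF.coe_le_one α 0)
  have hθ0 : 0 ≤ θ := by rw [hθ]; positivity
  have hθ1 : θ ≤ 1 := by linarith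
  set s₁ : SystemState K Z := fun k => (s k).serve t π with hs₁
  have hs₁v : ValidState (t b) s₁ := fun k => (hs k).serve ht
  set ζ : ℝ≥0∞ := expect ν fun v => ((size v - ℓ : ℕ) : ℝ≥0∞) with hζ
  set U : SystemState K Z → ℝ := fun s => ∑ k, ((s k).giantBound ℓ : ℝ) with hU
  set B : SystemState K Z → ℝ := fun s => ∑ k, (s k).bonus θ ℓ b (t b) with hB
  set G : SystemState K Z → ℝ := fun s => ∑ k, (s k).giantLyapunov θ ℓ b (t b) with hG
  have hU0 : ∀ s, 0 ≤ U s := fun s => Finset.sum_nonneg fun _ _ => by positivity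
  have hB0 : ∀ s, 0 ≤ B s := fun s => Finset.sum_nonneg fun _ _ =>
    EngineState.bonus_nonneg hθ0 _
  have hG0 : ∀ s, 0 ≤ G s := fun s => Finset.sum_nonneg fun _ _ =>
    EngineState.giantLyapunov_nonneg hθ0 hθ1 _
  have hGUB : ∀ s, G s + B s = U s := fun s => by
    simp only [hG, hB, hU, ← Finset.sum_add_distrib]
    exact Finset.sum_congr rfl fun k _ => sub_add_cancel _ _
  have hUarr : ∀ n, expect (addArrivals ν ρ n s₁) (fun s' => ENNReal.ofReal (U s'))
      ≤ ENNReal.ofReal (U s₁) + n * (3 * ζ) := by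
    intro n
    have := expect_addArrivals_le (ν := ν) (ρ := ρ) (T := t b)
      (V := fun s' => ENNReal.ofReal (U s')) (A := fun _ => 0)
      (a := fun _ => 0) (c := 0) (d := 3 * ζ) (γ := 0) ?_ (by simp) (by simp)
      (by simp [expect_const]) n s₁ hs₁v
    · simpa using this
    intro s _
    calc _ ≤ expect ν (fun v => expect (ρ s) fun k => ENNReal.ofReal (U s)
          + 3 * ((size v - ℓ : ℕ) : ℝ≥0∞)) := by
          refine expect_mono fun v => expect_mono fun k => ?_
          have h1 := sum_update_le (f := fun e : EngineState Z => (e.giantBound ℓ : ℝ))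
            (EngineState.giantBound_push_le (e := s k) (ℓ := ℓ) v)
          refine (ENNReal.ofReal_le_ofReal h1).trans (le_of_eq ?_)
          rw [ENNReal.ofReal_add (hU0 s) (by positivity), ENNReal.ofReal_mul (by norm_num),
            ENNReal.ofReal_natCast]
          norm_num
      _ = _ := by
          simp only [expect_add, expect_const, expect_const_mul, ← hζ]
          simp
  -- Arrivals may raise the small level and destroy the bonus, so it is subtracted only when `n =
  -- 0`; for other `n`, `G ≤ U` is enough.
  have harr : ∀ n, expect (addArrivals ν ρ n s₁) (fun s' => ENNReal.ofReal (G s'))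
      + (if n = 0 then ENNReal.ofReal (B s₁) else 0) ≤ ENNReal.ofReal (U s₁) + n * (3 * ζ) := by
    intro n
    by_cases hn : n = 0
    · subst hn
      simp only [addArrivals, expect_pure, if_true]
      rw [← ENNReal.ofReal_add (hG0 _) (hB0 _), hGUB]
      simp
    · rw [if_neg hn, add_zero]
      refine le_trans (expect_mono fun s' => ENNReal.ofReal_le_ofReal ?_) (hUarr n)
      linarith [hGUB s', hB0 s']
  have hα : expect α (fun n => if n = 0 then ENNReal.ofReal (B s₁) else 0)
      = α 0 * ENNReal.ofReal (B s₁) := by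
    unfold expect
    rw [tsum_eq_single 0]
    · simp
    · intro n hn; simp [hn]
  have hstep : expect (step t α ν π ρ s) (fun s' => ENNReal.ofReal (G s'))
      + α 0 * ENNReal.ofReal (B s₁)
      ≤ ENNReal.ofReal (U s₁) + expect α (fun n => (n : ℝ≥0∞)) * (3 * ζ) := by
    unfold step
    rw [expect_bind, ← hα, ← expect_add, ← expect_mul_const,
      ← expect_const α (ENNReal.ofReal (U s₁)), ← expect_add]
    exact expect_mono harr
  have hserve : U s₁ + B s ≤ G s + (α 0).toReal * B s₁ := by
    simp only [hU, hB, hG, Finset.mul_sum, ← Finset.sum_add_distrib]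
    exact Finset.sum_le_sum fun k _ => EngineState.giantBound_serve_add_bonus_le hp0 hθ0 hθ1
      (by linarith) hb ht1 (hs k) (hwc k)
  have hα0 : α 0 ≠ ∞ := PMF.apply_ne_top α 0
  have hserve' := ENNReal.ofReal_le_ofReal hserve
  rw [ENNReal.ofReal_add (hU0 _) (hB0 _), ENNReal.ofReal_add (hG0 _) (mul_nonneg hp0 (hB0 _)),
    ENNReal.ofReal_mul hp0, ENNReal.ofReal_toReal hα0] at hserve'
  refine (ENNReal.add_le_add_iff_right
    (ENNReal.mul_ne_top hα0 (ENNReal.ofReal_ne_top (r := B s₁)))).1 ?_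
  calc expect (step t α ν π ρ s) (fun s' => ENNReal.ofReal (G s')) + ENNReal.ofReal (B s)
        + α 0 * ENNReal.ofReal (B s₁)
      = expect (step t α ν π ρ s) (fun s' => ENNReal.ofReal (G s'))
        + α 0 * ENNReal.ofReal (B s₁) + ENNReal.ofReal (B s) := by ring
    _ ≤ ENNReal.ofReal (U s₁) + expect α (fun n => (n : ℝ≥0∞)) * (3 * ζ)
        + ENNReal.ofReal (B s) := by gcongr
    _ = (ENNReal.ofReal (U s₁) + ENNReal.ofReal (B s))
        + expect α (fun n => (n : ℝ≥0∞)) * (3 * ζ) := by ring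
    _ ≤ (ENNReal.ofReal (G s) + α 0 * ENNReal.ofReal (B s₁))
        + expect α (fun n => (n : ℝ≥0∞)) * (3 * ζ) := by gcongr
    _ = _ := by ring

end LLMServing

/-! ### Thresholds, gaps and the combined Lyapunov function. -/

namespace LLMServing

open MarkovChain

variable {Z : Type*} {b K : ℕ}

/-- The engine states with bounded remaining time, number of requests and token numbers. -/
lemma finite_engineStates [Finite Z] (T a M : ℕ) :
    {e : EngineState Z | e.remaining ≤ T ∧ e.queue.length ≤ a ∧
      ∀ q ∈ e.queue, q.tokens ≤ M}.Finite := by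
  have hR : {q : Request Z | q.tokens ≤ M}.Finite := by
    have h := ((Set.finite_Iic M).prod ((Set.finite_Iic M).prod (Set.finite_univ (α := Z)))).image
      (fun x : ℕ × ℕ × Z => (⟨x.1, x.2.1, x.2.2⟩ : Request Z))
    refine h.subset fun q hq => ⟨(q.prefill, q.decode, q.feature), ?_, rfl⟩
    have hq' : q.prefill + q.decode ≤ M := hq
    simp only [Set.mem_prod, Set.mem_Iic, Set.mem_univ, and_true]
    omega
  have : Finite {q : Request Z | q.tokens ≤ M} := hR
  have hL : {l : List (Request Z) | l.length ≤ a ∧ ∀ q ∈ l, q.tokens ≤ M}.Finite := by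
    refine ((List.finite_length_le {q : Request Z | q.tokens ≤ M} a).image
      (List.map Subtype.val)).subset fun l hl => ?_
    refine ⟨l.attach.map fun q => ⟨q.1, hl.2 q.1 q.2⟩, ?_, ?_⟩
    · rw [Set.mem_ofPred_eq, List.length_map, List.length_attach]
      exact hl.1
    simp [List.map_map, Function.comp_def]
  refine (((Set.finite_Iic T).prod hL).image
    (fun x : ℕ × List (Request Z) => (⟨x.1, x.2⟩ : EngineState Z))).subset fun e he => ?_
  exact ⟨(e.remaining, e.queue), ⟨he.1, he.2⟩, rfl⟩

namespace EngineState

variable {e : EngineState Z} {u : ℕ → ℕ} {L : ℕ}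

/-- Each request still has a decode token, hence contributes at least 1 to `total u`. -/
lemma length_le_level (hu : Counting u L) {T : ℕ} (hT : 1 ≤ T) (he : e.Valid T) :
    e.queue.length ≤ e.level b T u := by
  have h1 : e.queue.length ≤ e.total u := by
    rw [total_eq_sum]
    calc e.queue.length = ∑ _i : Fin e.queue.length, 1 := by simp
      _ ≤ _ := Finset.sum_le_sum fun i _ => hu.pos _ (by
        have := he.2 _ (e.queue.get_mem i)
        unfold Request.tokens
        omega)
  unfold level
  nlinarith

/-- Among sufficiently many levels there are two consecutive ones such that no request has a token
number in between. -/
lemma exists_gap {a : ℕ} (ha : e.queue.length < a) {ℓ : ℕ → ℕ} (hℓ : Monotone ℓ) :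
    ∃ i < a, ∀ j : Fin e.queue.length,
      (e.queue.get j).tokens ≤ ℓ i ∨ ℓ (i + 1) < (e.queue.get j).tokens := by
  by_contra! hcon
  -- A request in each of `a` disjoint intervals would give an injection into fewer than `a`
  -- requests.
  choose f hf using fun i : Fin a => hcon i i.2
  have hinj : Function.Injective f := by
    have key : ∀ i j : Fin a, i < j → f i ≠ f j := by
      intro i j hij heq
      have h1 := (hf i).2
      have h2 := (hf j).1
      rw [heq] at h1
      have := hℓ (show (i : ℕ) + 1 ≤ j from hij)
      omega
    intro i j heq
    rcases lt_trichotomy i j with h | h | h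
    · exact absurd heq (key i j h)
    · exact h
    · exact absurd heq.symm (key j i h)
  have := Fintype.card_le_of_injective f hinj
  simp at this
  omega

/-- Across a gap, requests with at most `ℓ'` tokens have at most `ℓ`. The bound is therefore free of
`ℓ'`, which can be chosen afterwards. -/
lemma level_small_le {a T ℓ ℓ' : ℕ} (ha : e.level b T u < a) (hlen : e.queue.length < a)
    (hgap : ∀ j : Fin e.queue.length,
      (e.queue.get j).tokens ≤ ℓ ∨ ℓ' < (e.queue.get j).tokens) :
    e.level b T (small ℓ') ≤ T * a * ℓ + a := by
  have h1 : e.total (small ℓ') ≤ a * ℓ := by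
    rw [total_eq_sum]
    calc _ ≤ ∑ _j : Fin e.queue.length, ℓ := Finset.sum_le_sum fun j _ => by
          have := hgap j
          unfold small
          split_ifs <;> omega
      _ = e.queue.length * ℓ := by simp
      _ ≤ a * ℓ := by gcongr
  unfold level at ha ⊢
  have h2 := Nat.mul_le_mul_left T h1
  rw [mul_assoc]
  omega

end EngineState

/-- Positive recurrence from a drift of the system Lyapunov function that is only negative when
the level of some engine is high. -/
lemma isPositiveRecurrentOn_of_average_drift [Finite Z] [NeZero K] {t : ℕ → ℕ} {α : PMF ℕ}
    {ν : PMF (ℕ+ × ℕ+ × Z)} {π : Scheduler Z b} {ρ : Router K Z} {X : Set (SystemState K Z)}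
    (hclosed : ∀ s ∈ X, ∀ s' ∈ (step t α ν π ρ s).support, s' ∈ X)
    (hvalid : ∀ s ∈ X, ValidState (t b) s)
    (hwc : ∀ s ∈ X, ∀ k, (s k).remaining = 0 → π.WorkConservingAt (s k).queue)
    (hirr : IsIrreducibleOn (step t α ν π ρ) X) (hb : 1 ≤ b) (ht : Monotone t) (ht1 : 1 ≤ t b)
    (hα0 : α 0 ≠ 0) (hΛ : expect α (fun n => (n : ℝ≥0∞)) ≠ ∞)
    (hζ : Filter.Tendsto (fun ℓ : ℕ => expect ν fun v => ((size v - ℓ : ℕ) : ℝ≥0∞))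
      Filter.atTop (nhds 0))
    {g : ℕ → ℝ} (hg : SlowlyGrowing g) {u : ℕ → ℕ} {L a : ℕ} (hu : Counting u L) (hga : g a = 1)
    {δ : ℝ} (hδ : 0 < δ)
    (hdrift : ∀ s ∈ X, expect (step t α ν π ρ s)
        (fun s' => ENNReal.ofReal (systemLyapunov g u L b (t b) s'))
        + ENNReal.ofReal (4 * δ * K) * ENNReal.ofReal (average g u b (t b) s)
      ≤ ENNReal.ofReal (systemLyapunov g u L b (t b) s) + ENNReal.ofReal δ) :
    IsPositiveRecurrentOn (step t α ν π ρ) X := by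
  set θ : ℝ := (α 0).toReal / 2 with hθ
  have hθ0 : 0 < θ := half_pos (ENNReal.toReal_pos hα0 (PMF.apply_ne_top α 0))
  have hθ1 : θ ≤ 1 := by
    have hp1 : (α 0).toReal ≤ 1 := ENNReal.toReal_le_of_le_ofReal zero_le_one
      (by simpa using PMF.coe_le_one α 0)
    linarith
  set T := t b with hT
  set Λ := expect α (fun n => (n : ℝ≥0∞)) with hΛ'
  -- Normalised so that the least bonus allowed by `level_small_le` is worth `4 * δ`.
  set D : ℕ → ℝ := fun ℓ => 4 * δ / θ ^ (T * a * ℓ + a) with hD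
  have hD0 : ∀ ℓ, 0 ≤ D ℓ := fun ℓ => by positivity
  -- The weight belongs to the lower end of the gap and the error to the upper end, so the next
  -- threshold can make the weighted error small. The `a` errors add up to at most `δ`.
  have hnext : ∀ ℓ, ∃ ℓ', ℓ ≤ ℓ' ∧ ENNReal.ofReal (D ℓ) *
      (Λ * (3 * expect ν fun v => ((size v - ℓ' : ℕ) : ℝ≥0∞))) ≤ ENNReal.ofReal (δ / (a + 1)) := by
    intro ℓ
    have h1 : Filter.Tendsto (fun ℓ' : ℕ => ENNReal.ofReal (D ℓ) *
        (Λ * (3 * expect ν fun v => ((size v - ℓ' : ℕ) : ℝ≥0∞)))) Filter.atTop (nhds 0) := by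
      have := ENNReal.Tendsto.const_mul (a := ENNReal.ofReal (D ℓ))
        (ENNReal.Tendsto.const_mul (a := Λ) (ENNReal.Tendsto.const_mul (a := 3) hζ
          (Or.inr (by norm_num))) (Or.inr hΛ)) (Or.inr ENNReal.ofReal_ne_top)
      simpa using this
    have h2 : (0 : ℝ≥0∞) < ENNReal.ofReal (δ / (a + 1)) := ENNReal.ofReal_pos.2 (by positivity)
    obtain ⟨ℓ', h3, h4⟩ := ((Filter.eventually_ge_atTop ℓ).and (h1.eventually_lt_const h2)).exists
    exact ⟨ℓ', h3, h4.le⟩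
  choose nxt hnxt hnxt' using hnext
  set ℓ : ℕ → ℕ := fun i => nxt^[i] 0 with hℓ
  have hℓs : ∀ i, ℓ (i + 1) = nxt (ℓ i) := fun i => Function.iterate_succ_apply' _ _ _
  have hℓmono : Monotone ℓ := monotone_nat_of_le_succ fun i => by rw [hℓs]; exact hnxt _
  set G : ℕ → SystemState K Z → ℝ := fun i s => ∑ k, (s k).giantLyapunov θ (ℓ (i + 1)) b T with hG
  set B : ℕ → SystemState K Z → ℝ := fun i s => ∑ k, (s k).bonus θ (ℓ (i + 1)) b T with hB
  set F : SystemState K Z → ℝ≥0∞ := fun s => ENNReal.ofReal (systemLyapunov g u L b T s) with hF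
  set V : SystemState K Z → ℝ≥0∞ := fun s =>
    F s + ∑ i ∈ Finset.range a, ENNReal.ofReal (D (ℓ i)) * ENNReal.ofReal (G i s) with hV
  have hmain : ∀ s ∈ X, expect (step t α ν π ρ s) V
      + (ENNReal.ofReal (4 * δ * K) * ENNReal.ofReal (average g u b T s)
        + ∑ i ∈ Finset.range a, ENNReal.ofReal (D (ℓ i)) * ENNReal.ofReal (B i s))
      ≤ V s + ENNReal.ofReal (2 * δ) := by
    intro s hs
    have h1 := hdrift s hs
    have h2 : ∀ i ∈ Finset.range a,
        ENNReal.ofReal (D (ℓ i)) * expect (step t α ν π ρ s) (fun s' => ENNReal.ofReal (G i s'))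
          + ENNReal.ofReal (D (ℓ i)) * ENNReal.ofReal (B i s)
        ≤ ENNReal.ofReal (D (ℓ i)) * ENNReal.ofReal (G i s) + ENNReal.ofReal (δ / (a + 1)) := by
      intro i _
      have h3 := expect_step_giantLyapunov (t := t) (α := α) (ν := ν) (π := π) (ρ := ρ) hb ht ht1
        (hvalid s hs) (hwc s hs) hθ (ℓ (i + 1))
      rw [← mul_add]
      refine (mul_le_mul_right h3 _).trans ?_
      rw [mul_add]
      gcongr
      rw [hℓs]
      exact hnxt' (ℓ i)
    have h3 := Finset.sum_le_sum h2
    simp only [Finset.sum_add_distrib, Finset.sum_const, Finset.card_range, nsmul_eq_mul] at h3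
    have h4 : (a : ℝ≥0∞) * ENNReal.ofReal (δ / (a + 1)) ≤ ENNReal.ofReal δ := by
      rw [← ENNReal.ofReal_natCast, ← ENNReal.ofReal_mul (by positivity)]
      refine ENNReal.ofReal_le_ofReal ?_
      have ha : (0 : ℝ) ≤ a := by positivity
      rw [mul_div_assoc', div_le_iff₀ (by positivity)]
      nlinarith
    have h5 : expect (step t α ν π ρ s) V = expect (step t α ν π ρ s) F
        + ∑ i ∈ Finset.range a, ENNReal.ofReal (D (ℓ i)) *
          expect (step t α ν π ρ s) (fun s' => ENNReal.ofReal (G i s')) := by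
      simp only [hV, expect_add, expect_finset_sum, expect_const_mul]
    have h6 : ENNReal.ofReal (2 * δ) = ENNReal.ofReal δ + ENNReal.ofReal δ := by
      rw [← ENNReal.ofReal_add hδ.le hδ.le, two_mul]
    rw [h5, h6]
    calc _ = (expect (step t α ν π ρ s) F
          + ENNReal.ofReal (4 * δ * K) * ENNReal.ofReal (average g u b T s))
          + (∑ i ∈ Finset.range a, ENNReal.ofReal (D (ℓ i)) *
              expect (step t α ν π ρ s) (fun s' => ENNReal.ofReal (G i s'))
            + ∑ i ∈ Finset.range a, ENNReal.ofReal (D (ℓ i)) * ENNReal.ofReal (B i s)) := by ring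
      _ ≤ (F s + ENNReal.ofReal δ)
          + (∑ i ∈ Finset.range a, ENNReal.ofReal (D (ℓ i)) * ENNReal.ofReal (G i s)
            + ENNReal.ofReal δ) := by
          exact add_le_add h1 (h3.trans (add_le_add le_rfl h4))
      _ = _ := by simp only [hV]; ring
  refine isPositiveRecurrentOn_of_drift hclosed hirr
    (C := {s | ∀ k, s k ∈ {e : EngineState Z | e.remaining ≤ T ∧ e.queue.length ≤ a ∧
      ∀ q ∈ e.queue, q.tokens ≤ ℓ a}}) ?_ V ?_
    (δ := ENNReal.ofReal (2 * δ)) (M := ENNReal.ofReal (2 * δ))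
    (ENNReal.ofReal_pos.2 (by positivity)).ne' ENNReal.ofReal_ne_top ENNReal.ofReal_ne_top ?_ ?_
  · have := Set.Finite.pi' fun _ : Fin K => finite_engineStates (Z := Z) T a (ℓ a)
    exact this
  · intro s _
    exact ENNReal.add_ne_top.2 ⟨ENNReal.ofReal_ne_top, ENNReal.sum_ne_top.2 fun i _ =>
      ENNReal.mul_ne_top ENNReal.ofReal_ne_top ENNReal.ofReal_ne_top⟩
  · intro s hs
    exact le_self_add.trans (hmain s hs)
  · intro s hs hsC
    -- Either some level reaches `a`, where `g = 1` and the average is at least `1 / K`, or all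
    -- queues are shorter than `a` and some request exceeds `ℓ a` tokens; then the gap in its engine
    -- supplies the bonus. The gain `4 * δ` is twice the total error `2 * δ`.
    have hgain : ENNReal.ofReal (4 * δ)
        ≤ ENNReal.ofReal (4 * δ * K) * ENNReal.ofReal (average g u b T s)
          + ∑ i ∈ Finset.range a, ENNReal.ofReal (D (ℓ i)) * ENNReal.ofReal (B i s) := by
      by_cases hhigh : ∃ k, a ≤ (s k).level b T u
      · obtain ⟨k, hk⟩ := hhigh
        refine le_trans ?_ le_self_add
        rw [← ENNReal.ofReal_mul (by positivity)]
        refine ENNReal.ofReal_le_ofReal ?_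
        have h1 : g ((s k).level b T u) ≤ ∑ k, g ((s k).level b T u) :=
          Finset.single_le_sum (f := fun k => g ((s k).level b T u))
            (fun _ _ => hg.nonneg _) (Finset.mem_univ k)
        have h2 : 1 ≤ g ((s k).level b T u) := hga.symm.le.trans (hg.mono hk)
        have hK : (K : ℝ) ≠ 0 := by exact_mod_cast NeZero.ne K
        unfold average
        rw [mul_assoc, mul_div_cancel₀ _ hK]
        nlinarith
      · push Not at hhigh
        have hlen : ∀ k, (s k).queue.length < a := fun k =>
          (EngineState.length_le_level hu ht1 (hvalid s hs k)).trans_lt (hhigh k)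
        obtain ⟨k, q, hq, hqa⟩ : ∃ k, ∃ q ∈ (s k).queue, ℓ a < q.tokens := by
          by_contra! hcon
          exact hsC fun k => ⟨(hvalid s hs k).1, (hlen k).le, hcon k⟩
        obtain ⟨i, hi, hgap⟩ := EngineState.exists_gap (hlen k) hℓmono
        have hexc : (s k).excess (ℓ (i + 1)) ≠ 0 := by
          intro h0
          rw [EngineState.excess, EngineState.total, List.sum_eq_zero_iff] at h0
          have h1 := h0 _ (List.mem_map_of_mem hq)
          have h2 := hℓmono (show i + 1 ≤ a from hi)
          omega
        have hB1 : θ ^ (T * a * ℓ i + a) ≤ B i s := by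
          have h1 : (s k).bonus θ (ℓ (i + 1)) b T ≤ B i s :=
            Finset.single_le_sum (f := fun k => (s k).bonus θ (ℓ (i + 1)) b T)
              (fun _ _ => EngineState.bonus_nonneg hθ0.le _) (Finset.mem_univ k)
          refine le_trans ?_ h1
          rw [EngineState.bonus, if_neg hexc]
          exact pow_le_pow_of_le_one hθ0.le hθ1
            (EngineState.level_small_le (hhigh k) (hlen k) hgap)
        refine le_trans ?_ le_add_self
        refine le_trans ?_ (Finset.single_le_sum (fun _ _ => zero_le)
          (Finset.mem_range.2 hi))
        rw [← ENNReal.ofReal_mul (hD0 _)]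
        refine ENNReal.ofReal_le_ofReal ?_
        have h2 : D (ℓ i) * θ ^ (T * a * ℓ i + a) = 4 * δ :=
          div_mul_cancel₀ _ (pow_pos hθ0 _).ne'
        rw [← h2]
        exact mul_le_mul_of_nonneg_left hB1 (hD0 _)
    have h1 : ENNReal.ofReal (4 * δ) = ENNReal.ofReal (2 * δ) + ENNReal.ofReal (2 * δ) := by
      rw [← ENNReal.ofReal_add (by positivity) (by positivity)]
      ring_nf
    refine (ENNReal.add_le_add_iff_right (ENNReal.ofReal_ne_top (r := 2 * δ))).1 ?_
    rw [add_assoc, ← h1]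
    refine le_trans ?_ (hmain s hs)
    gcongr

end LLMServing

/-! ### Dominated convergence and vanishing error terms. -/

namespace MarkovChain

open Filter

variable {S : Type*}

lemma expect_natCast {p : PMF S} {f : S → ℕ} {x : ℝ}
    (h : HasSum (fun z => (p z).toReal * (f z : ℝ)) x) :
    expect p (fun z => (f z : ℝ≥0∞)) = ENNReal.ofReal x := by
  rw [← h.tsum_eq, ENNReal.ofReal_tsum_of_nonneg (fun z => by positivity) h.summable]
  refine tsum_congr fun z => ?_
  rw [ENNReal.ofReal_mul ENNReal.toReal_nonneg, ENNReal.ofReal_toReal (PMF.apply_ne_top p z),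
    ENNReal.ofReal_natCast]

/-- Dominated convergence to zero. -/
lemma tendsto_expect {p : PMF S} {F : ℕ → S → ℝ≥0∞} {bound : S → ℝ≥0∞}
    (hbound : ∀ n z, F n z ≤ bound z) (hfin : expect p bound ≠ ∞)
    (hlim : ∀ z, Tendsto (fun n => F n z) atTop (nhds 0)) :
    Tendsto (fun n => expect p (F n)) atTop (nhds 0) := by
  let _ : MeasurableSpace S := ⊤
  have h := MeasureTheory.tendsto_lintegral_of_dominated_convergence
    (μ := MeasureTheory.Measure.count) (F := fun n z => p z * F n z) (f := fun _ => 0)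
    (fun z => p z * bound z) (fun _ => measurable_from_top)
    (fun n => MeasureTheory.ae_of_all _ fun z => mul_le_mul_right (hbound n z) _)
    (by rwa [MeasureTheory.lintegral_count]) (MeasureTheory.ae_of_all _ fun z => by
      simpa using ENNReal.Tendsto.const_mul (hlim z) (Or.inr (PMF.apply_ne_top p z)))
  simpa [MeasureTheory.lintegral_count, expect] using h

end MarkovChain

namespace LLMServing

open MarkovChain Filter

variable {Z : Type*} {b K : ℕ}

lemma tendsto_truncLog (n : ℕ) :
    Tendsto (fun j : ℕ => ENNReal.ofReal (truncLog (1 / (j + 1)) n)) atTop (nhds 0) := by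
  have h1 : Tendsto (fun j : ℕ => (1 : ℝ) / (j + 1) * Real.log (1 + n)) atTop (nhds 0) := by
    simpa using (tendsto_one_div_add_atTop_nhds_zero_nat (𝕜 := ℝ)).mul_const (Real.log (1 + n))
  have h2 : Tendsto (fun j : ℕ => truncLog (1 / (j + 1)) n) atTop (nhds 0) := by
    unfold truncLog
    simpa using (tendsto_const_nhds (x := (1 : ℝ))).min h1
  simpa using ENNReal.tendsto_ofReal h2

lemma exists_truncLog_eq_one {η : ℝ} (hη : 0 < η) : ∃ a : ℕ, truncLog η a = 1 := by
  obtain ⟨a, ha⟩ := exists_nat_ge (Real.exp (1 / η))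
  refine ⟨a, min_eq_left ?_⟩
  have h1 : 1 / η ≤ Real.log (1 + a) := by
    rw [Real.le_log_iff_exp_le (by positivity)]
    linarith
  calc (1 : ℝ) = η * (1 / η) := by field_simp
    _ ≤ η * Real.log (1 + a) := by gcongr

lemma tendsto_expect_excess {ν : PMF (ℕ+ × ℕ+ × Z)}
    (hm : expect ν (fun v => (size v : ℝ≥0∞)) ≠ ∞) :
    Tendsto (fun ℓ : ℕ => expect ν fun v => ((size v - ℓ : ℕ) : ℝ≥0∞)) atTop (nhds 0) := by
  refine tendsto_expect (fun ℓ v => ?_) hm fun v => ?_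
  · exact_mod_cast Nat.sub_le _ _
  · refine tendsto_const_nhds.congr' ?_
    filter_upwards [eventually_ge_atTop (size v)] with ℓ hℓ
    simp [Nat.sub_eq_zero_of_le hℓ]

/-- The error terms of the drift vanish for slowly growing truncated logarithms. -/
lemma tendsto_drift_error {α : PMF ℕ} {ν : PMF (ℕ+ × ℕ+ × Z)}
    (hm : expect ν (fun v => (size v : ℝ≥0∞)) ≠ ∞) (hΛ : expect α (fun n => (n : ℝ≥0∞)) ≠ ∞)
    {A₁ A₂ A₃ A₄ A₅ : ℝ≥0∞} (h₁ : A₁ ≠ ∞) (h₂ : A₂ ≠ ∞) (h₃ : A₃ ≠ ∞) (h₄ : A₄ ≠ ∞)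
    (h₅ : A₅ ≠ ∞) (n₁ n₂ n₃ T : ℕ) :
    Tendsto (fun j : ℕ =>
      A₁ * ENNReal.ofReal (truncLog (1 / (j + 1)) n₁)
      + A₂ * ENNReal.ofReal (truncLog (1 / (j + 1)) n₂)
      + A₃ * expect α (fun n => n * min 1 (n * expect ν fun v =>
          ENNReal.ofReal (truncLog (1 / (j + 1)) (T * size v))))
      + A₄ * (ENNReal.ofReal (truncLog (1 / (j + 1)) n₃)
        + ENNReal.ofReal (truncLog (1 / (j + 1)) n₂))
      + A₅ * expect ν (fun v => size v * ENNReal.ofReal (truncLog (1 / (j + 1)) (T * size v))))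
      atTop (nhds 0) := by
  have hle : ∀ (j n : ℕ), ENNReal.ofReal (truncLog (1 / (j + 1)) n) ≤ 1 := fun j n =>
    ENNReal.ofReal_le_one.2 (min_le_left _ _)
  have hγ : Tendsto (fun j : ℕ => expect ν fun v =>
      ENNReal.ofReal (truncLog (1 / (j + 1)) (T * size v))) atTop (nhds 0) :=
    tendsto_expect (bound := fun _ => 1) (fun j v => hle j _) (by simp [expect_const])
      fun v => tendsto_truncLog _
  have hα : Tendsto (fun j : ℕ => expect α (fun n => n * min 1 (n * expect ν fun v =>
      ENNReal.ofReal (truncLog (1 / (j + 1)) (T * size v))))) atTop (nhds 0) := by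
    refine tendsto_expect (fun j n => mul_le_of_le_one_right' (min_le_left _ _)) hΛ fun n => ?_
    have h1 : Tendsto (fun j : ℕ => (n : ℝ≥0∞) * expect ν fun v =>
        ENNReal.ofReal (truncLog (1 / (j + 1)) (T * size v))) atTop (nhds 0) := by
      simpa using ENNReal.Tendsto.const_mul hγ (Or.inr (ENNReal.natCast_ne_top n))
    have h2 := (tendsto_const_nhds (x := (1 : ℝ≥0∞))).min h1
    simpa using ENNReal.Tendsto.const_mul h2 (Or.inr (ENNReal.natCast_ne_top n))
  have hν : Tendsto (fun j : ℕ => expect ν (fun v => size v *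
      ENNReal.ofReal (truncLog (1 / (j + 1)) (T * size v)))) atTop (nhds 0) := by
    refine tendsto_expect (fun j v => mul_le_of_le_one_right' (hle j _)) hm fun v => ?_
    simpa using ENNReal.Tendsto.const_mul (tendsto_truncLog (T * size v))
      (Or.inr (ENNReal.natCast_ne_top (size v)))
  have := ((((ENNReal.Tendsto.const_mul (tendsto_truncLog n₁) (Or.inr h₁)).add
    (ENNReal.Tendsto.const_mul (tendsto_truncLog n₂) (Or.inr h₂))).add
    (ENNReal.Tendsto.const_mul hα (Or.inr h₃))).add
    (ENNReal.Tendsto.const_mul ((tendsto_truncLog n₃).add (tendsto_truncLog n₂)) (Or.inr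
      h₄))).add (ENNReal.Tendsto.const_mul hν (Or.inr h₅))
  simpa using this

/-! ### Load balancing -/

lemma le_average_add [NeZero K] {g : ℕ → ℝ} {u : ℕ → ℕ} {T : ℕ} {s : SystemState K Z} {x c : ℝ}
    (h : ∀ j, x ≤ g ((s j).level b T u) + c) : x ≤ average g u b T s + c := by
  have hK : (0 : ℝ) < K := by exact_mod_cast NeZero.pos K
  have h1 : ∑ _j : Fin K, x ≤ ∑ j, (g ((s j).level b T u) + c) :=
    Finset.sum_le_sum fun j _ => h j
  rw [Finset.sum_add_distrib] at h1
  simp only [Finset.sum_const, Finset.card_univ, Fintype.card_fin, nsmul_eq_mul] at h1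
  unfold average
  rw [← sub_le_iff_le_add, le_div_iff₀ hK]
  linarith

lemma balances_of_forall [NeZero K] {ρ : Router K Z} {g : ℕ → ℝ} (hg : SlowlyGrowing g)
    {u : ℕ → ℕ} {T : ℕ} {c₁ c₂ : ℝ} (hc₁ : 0 ≤ c₁) (hc₂ : 0 ≤ c₂)
    (h : ∀ s, ValidState T s → ∀ k ∈ (ρ s).support, ∀ j,
      g ((s k).level b T u) ≤ g ((s j).level b T u) + (c₁ + c₂)) :
    ρ.Balances g u b T (ENNReal.ofReal c₁ + ENNReal.ofReal c₂) := by
  intro s hs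
  rw [← expect_const (ρ s) (ENNReal.ofReal (average g u b T s) + _)]
  refine expect_mono_support fun k hk => ?_
  rw [← ENNReal.ofReal_add hc₁ hc₂,
    ← ENNReal.ofReal_add (average_nonneg hg T s) (add_nonneg hc₁ hc₂)]
  exact ENNReal.ofReal_le_ofReal (le_average_add (h s hs k hk))

lemma Router.IsUniform.balances [NeZero K] {ρ : Router K Z} (hρ : ρ.IsUniform) {g : ℕ → ℝ}
    (hg : SlowlyGrowing g) (u : ℕ → ℕ) (T : ℕ) (η : ℝ≥0∞) : ρ.Balances g u b T η := by
  intro s _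
  have hK : (0 : ℝ) < K := by exact_mod_cast NeZero.pos K
  refine le_trans (le_of_eq ?_) le_self_add
  rw [hρ s, expect, tsum_fintype, average, ENNReal.ofReal_div_of_pos hK,
    ENNReal.ofReal_sum_of_nonneg (fun _ _ => hg.nonneg _), ENNReal.ofReal_natCast,
    ENNReal.div_eq_inv_mul, Finset.mul_sum]
  simp [PMF.uniformOfFintype_apply]

/-- With `u` the identity the rule compares the token parts of the levels; only the clocks, worth at
most `b * T`, can disagree. -/
lemma Router.IsLeastTokens.balances [NeZero K] {ρ : Router K Z} (hρ : ρ.IsLeastTokens)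
    {g : ℕ → ℝ} (hg : SlowlyGrowing g) (L T : ℕ) :
    ρ.Balances g (fun w => w) b T
      (ENNReal.ofReal (g (T * L)) + ENNReal.ofReal (g (b * T))) := by
  refine balances_of_forall hg (hg.nonneg _) (hg.nonneg _) fun s hs k hk j => ?_
  have h1 : (s k).total (fun w => w) ≤ (s j).total (fun w => w) := hρ s k hk j
  have h2 : (s k).level b T (fun w => w) ≤ (s j).level b T (fun w => w) + b * T := by
    unfold EngineState.level
    have h3 := Nat.mul_le_mul_left T h1
    have h4 := Nat.mul_le_mul_left b (hs k).1
    omega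
  have := (hg.mono h2).trans (hg.add_le _ _)
  linarith [hg.nonneg (T * L)]

/-- With tokens truncated at `L`, level and queue length determine each other up to the factor `T *
L` and the clock. A logarithmic `g` makes this factor an additive error. -/
lemma Router.IsLeastRequests.balances [NeZero K] {ρ : Router K Z} (hρ : ρ.IsLeastRequests)
    {g : ℕ → ℝ} (hg : SlowlyGrowing g) {L T : ℕ} (hL : 1 ≤ L) (hT : 1 ≤ T) :
    ρ.Balances g (fun w => min w L) b T
      (ENNReal.ofReal (g (T * L)) + ENNReal.ofReal (g (b * T))) := by
  refine balances_of_forall hg (hg.nonneg _) (hg.nonneg _) fun s hs k hk j => ?_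
  have h1 : (s k).queue.length ≤ (s j).level b T (fun w => min w L) :=
    (hρ s k hk j).trans (EngineState.length_le_level (counting_min hL) hT (hs j))
  have h2 : (s k).total (fun w => min w L) ≤ (s k).queue.length * L := by
    rw [EngineState.total_eq_sum]
    calc _ ≤ ∑ _i : Fin (s k).queue.length, L := Finset.sum_le_sum fun i _ => min_le_right _ _
      _ = _ := by simp
  have h3 : (s k).level b T (fun w => min w L)
      ≤ (T * L) * (s j).level b T (fun w => min w L) + b * T := by
    have h4 := Nat.mul_le_mul_left T (h2.trans (Nat.mul_le_mul_right L h1))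
    have h5 := Nat.mul_le_mul_left b (hs k).1
    calc (s k).level b T (fun w => min w L)
        = T * (s k).total (fun w => min w L) + b * (s k).remaining := rfl
      _ ≤ T * ((s j).level b T (fun w => min w L) * L) + b * T := add_le_add h4 h5
      _ = _ := by ring
  have h6 := (hg.mono h3).trans (hg.add_le _ _)
  have h7 := hg.mul_le (T * L) ((s j).level b T (fun w => min w L))
  linarith

/-- Every load-balancing algorithm balances a suitable measure of the work of the engines. -/
lemma Router.IsLoadBalancing.exists_balances [NeZero K] {ρ : Router K Z} (hρ : ρ.IsLoadBalancing)
    {L T : ℕ} (hL : 1 ≤ L) (hT : 1 ≤ T) :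
    ∃ u : ℕ → ℕ, Counting u L ∧ ∀ g, SlowlyGrowing g →
      ρ.Balances g u b T (ENNReal.ofReal (g (T * L)) + ENNReal.ofReal (g (b * T))) := by
  rcases hρ with hρ | hρ | hρ
  · exact ⟨_, counting_id L, fun g hg => hρ.balances hg _ _ _⟩
  · exact ⟨_, counting_min hL, fun g hg => hρ.balances hg hL hT⟩
  · exact ⟨_, counting_id L, fun g hg => hρ.balances hg L T⟩

/-! ### Reachable states -/

lemma addArrivals_support {ν : PMF (ℕ+ × ℕ+ × Z)} {ρ : Router K Z} {p : SystemState K Z → Prop}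
    (hp : ∀ s v k, p s → p (arrive s v k)) (n : ℕ) {s s' : SystemState K Z} (hs : p s)
    (hs' : s' ∈ (addArrivals ν ρ n s).support) : p s' := by
  induction n generalizing s with
  | zero =>
    rw [addArrivals, PMF.mem_support_pure_iff] at hs'
    exact hs' ▸ hs
  | succ n ih =>
    simp only [addArrivals, PMF.mem_support_bind_iff] at hs'
    obtain ⟨v, -, k, -, h⟩ := hs'
    exact ih (hp s v k hs) h

lemma validState_of_mem_stateSpace {t : ℕ → ℕ} (ht : Monotone t) {α : PMF ℕ}
    {ν : PMF (ℕ+ × ℕ+ × Z)} {π : Scheduler Z b} {ρ : Router K Z} {s : SystemState K Z}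
    (hs : s ∈ stateSpace (step t α ν π ρ) (emptySystem K Z)) : ValidState (t b) s := by
  induction hs with
  | refl => exact fun k => ⟨Nat.zero_le _, by simp [emptySystem]⟩
  | tail _ h ih =>
    rw [step, PMF.mem_support_bind_iff] at h
    obtain ⟨n, -, h⟩ := h
    exact addArrivals_support (fun s v k hs => hs.arrive v k) n (fun k => (ih k).serve ht) h

/-- If the chain is irreducible, then there are slots without arrivals. -/
lemma apply_zero_ne_zero {t : ℕ → ℕ} {α : PMF ℕ} {ν : PMF (ℕ+ × ℕ+ × Z)} {π : Scheduler Z b}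
    {ρ : Router K Z} (hirr : IsIrreducibleOn (step t α ν π ρ)
      (stateSpace (step t α ν π ρ) (emptySystem K Z))) : α 0 ≠ 0 := by
  intro hα
  have hne : ∀ s s', s' ∈ (step t α ν π ρ s).support → s' ≠ emptySystem K Z := by
    intro s s' hs'
    rw [step, PMF.mem_support_bind_iff] at hs'
    obtain ⟨n, hn, h⟩ := hs'
    obtain ⟨m, rfl⟩ : ∃ m, n = m + 1 := Nat.exists_eq_succ_of_ne_zero fun h0 => by
      rw [h0, PMF.mem_support_iff] at hn
      exact hn hα
    simp only [addArrivals, PMF.mem_support_bind_iff] at h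
    obtain ⟨v, -, k, -, h⟩ := h
    have := addArrivals_support (p := fun s => ∃ k, (s k).queue ≠ []) ?_ m
      (s := arrive (fun k => (s k).serve t π) v k) ⟨k, ?_⟩ h
    · obtain ⟨j, hj⟩ := this
      rintro rfl
      exact hj rfl
    · rintro s v k ⟨j, hj⟩
      refine ⟨j, ?_⟩
      by_cases hjk : j = k
      · subst hjk; simp [EngineState.push]
      · simpa [hjk] using hj
    · simp [EngineState.push]
  obtain ⟨s, hs⟩ := (step t α ν π ρ (emptySystem K Z)).support_nonempty
  have hreach := hirr s (Relation.ReflTransGen.single hs) _ Relation.ReflTransGen.refl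
  rcases Relation.ReflTransGen.cases_tail hreach with h | ⟨s', -, h⟩
  · exact hne _ _ hs h.symm
  · exact hne _ _ h rfl

/-! ### Choice of the parameters. -/

/-- Positive recurrence of the system under a work-conserving scheduler. -/
theorem isPositiveRecurrentOn_stateSpace [Finite Z] [NeZero K] {t : ℕ → ℕ}
    (ht_pos : ∀ n, 1 ≤ t n) (ht_mono : Monotone t) {α : PMF ℕ} {ν : PMF (ℕ+ × ℕ+ × Z)}
    {lam mp md : ℝ} (hlam : HasSum (fun n : ℕ => (α n).toReal * (n : ℝ)) lam)
    (hmp : HasSum (fun v : ℕ+ × ℕ+ × Z => (ν v).toReal * ((v.1 : ℕ) : ℝ)) mp)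
    (hmd : HasSum (fun v : ℕ+ × ℕ+ × Z => (ν v).toReal * ((v.2.1 : ℕ) : ℝ)) md)
    {ρ : Router K Z} (hρ : ρ.IsLoadBalancing) {π : Scheduler Z b} {X : Set (SystemState K Z)}
    (hX : X = stateSpace (step t α ν π ρ) (emptySystem K Z))
    (hwc : ∀ s ∈ X, ∀ k, (s k).remaining = 0 → π.WorkConservingAt (s k).queue)
    (hirr : IsIrreducibleOn (step t α ν π ρ) X)
    (hload : lam * (mp + md) < (K : ℝ) * (b : ℝ) / (t b : ℝ)) :
    IsPositiveRecurrentOn (step t α ν π ρ) X := by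
  have hK : (0 : ℝ) < K := by exact_mod_cast NeZero.pos K
  have hT1 := ht_pos b
  have hT : (0 : ℝ) < t b := by exact_mod_cast hT1
  have hlam0 : 0 ≤ lam := hlam.nonneg fun n => by positivity
  have hm0 : 0 ≤ mp + md :=
    add_nonneg (hmp.nonneg fun v => by positivity) (hmd.nonneg fun v => by positivity)
  have hb : 1 ≤ b := by
    rcases Nat.eq_zero_or_pos b with rfl | hb
    · simp only [Nat.cast_zero, mul_zero, zero_div] at hload
      exact absurd hload (not_lt.2 (mul_nonneg hlam0 hm0))
    · exact hb
  have hΛ : expect α (fun n => (n : ℝ≥0∞)) = ENNReal.ofReal lam := expect_natCast hlam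
  have hm : expect ν (fun v => (size v : ℝ≥0∞)) = ENNReal.ofReal (mp + md) := by
    refine expect_natCast ((hmp.add hmd).congr_fun ?_)
    intro v
    simp only [size]
    push_cast
    ring
  have hΛtop : expect α (fun n => (n : ℝ≥0∞)) ≠ ∞ := hΛ ▸ ENNReal.ofReal_ne_top
  have hmtop : expect ν (fun v => (size v : ℝ≥0∞)) ≠ ∞ := hm ▸ ENNReal.ofReal_ne_top
  have hα0 : α 0 ≠ 0 := apply_zero_ne_zero (by rwa [hX] at hirr)
  have hζ := tendsto_expect_excess hmtop
  -- The spare capacity, written as `4 * δ * K`, is the coefficient of the average in the final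
  -- drift.
  obtain ⟨δ, hδ, hδeq⟩ : ∃ δ : ℝ, 0 < δ ∧ t b * (mp + md) * lam + 4 * δ * K = K * b := by
    rw [lt_div_iff₀ hT] at hload
    refine ⟨(K * b - lam * (mp + md) * t b) / (4 * K), div_pos (by linarith) (by linarith), ?_⟩
    field_simp
    ring
  have hδ2 : (0 : ℝ≥0∞) < ENNReal.ofReal (δ / 2) := ENNReal.ofReal_pos.2 (by positivity)
  -- The order of choices matters: `L` makes the excess error at most `δ / 2`, then `u` depends on
  -- `L`, then `g` is taken flat enough for the remaining errors, which involve `L`, and finally `a`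
  -- is a point where `g` has reached 1.
  obtain ⟨L, hL1, hL⟩ : ∃ L, 1 ≤ L ∧ expect α (fun n => (n : ℝ≥0∞)) *
      ((b * t b + b + t b : ℕ) * expect ν fun v => ((size v - L : ℕ) : ℝ≥0∞))
        < ENNReal.ofReal (δ / 2) := by
    have h := ENNReal.Tendsto.const_mul (ENNReal.Tendsto.const_mul hζ
      (Or.inr (ENNReal.natCast_ne_top (b * t b + b + t b)))) (Or.inr hΛtop)
    simp only [mul_zero] at h
    exact ((eventually_ge_atTop 1).and (h.eventually_lt_const hδ2)).exists
  obtain ⟨u, hu, hbal⟩ := hρ.exists_balances (b := b) hL1 hT1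
  set Λ := expect α (fun n => (n : ℝ≥0∞)) with hΛdef
  set m := expect ν (fun v => (size v : ℝ≥0∞)) with hmdef
  have herr := tendsto_drift_error hmtop hΛtop
    (A₁ := (K * (b + b * t b) : ℕ)) (A₂ := t b * m * Λ) (A₃ := t b * m) (A₄ := Λ * (t b * m))
    (A₅ := Λ * t b) (ENNReal.natCast_ne_top _) (by finiteness) (by finiteness) (by finiteness)
    (by finiteness) (b + t b * (b * L) + b * t b) (b * t b) (t b * L) (t b)
  obtain ⟨j, hj⟩ := (herr.eventually_lt_const hδ2).exists
  have hη : (0 : ℝ) < 1 / (j + 1) := by positivity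
  set g := truncLog (1 / (j + 1)) with hgdef
  have hg : SlowlyGrowing g := slowlyGrowing_truncLog hη.le
  obtain ⟨a, ha⟩ := exists_truncLog_eq_one hη
  have hclosed : ∀ s ∈ X, ∀ s' ∈ (step t α ν π ρ s).support, s' ∈ X := by
    intro s hs s' hs'
    rw [hX] at hs ⊢
    exact Relation.ReflTransGen.tail hs hs'
  have hvalid : ∀ s ∈ X, ValidState (t b) s := fun s hs =>
    validState_of_mem_stateSpace ht_mono (hX ▸ hs)
  refine isPositiveRecurrentOn_of_average_drift hclosed hvalid hwc hirr hb ht_mono hT1 hα0 hΛtop hζ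
    hg hu ha hδ fun s hs => ?_
  have hd := expect_step_systemLyapunov (α := α) (ν := ν) hg (hbal g hg) hu ht_mono hT1
    (hvalid s hs) (hwc s hs) hmdef hΛdef rfl
  have hμ : (t b : ℝ≥0∞) * m * Λ = ENNReal.ofReal (t b * (mp + md) * lam) := by
    rw [hm, hΛ, ENNReal.ofReal_mul (by positivity), ENNReal.ofReal_mul (by positivity),
      ENNReal.ofReal_natCast]
  have hKb : ((K * b : ℕ) : ℝ≥0∞)
      = ENNReal.ofReal (t b * (mp + md) * lam) + ENNReal.ofReal (4 * δ * K) := by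
    rw [← ENNReal.ofReal_add (by positivity) (by positivity), hδeq, ← ENNReal.ofReal_natCast]
    push_cast
    rfl
  have hδs : ENNReal.ofReal δ = ENNReal.ofReal (δ / 2) + ENNReal.ofReal (δ / 2) := by
    rw [← ENNReal.ofReal_add (by positivity) (by positivity), add_halves]
  set Av := ENNReal.ofReal (average g u b (t b) s) with hAv
  have hcancel : ENNReal.ofReal (t b * (mp + md) * lam) * Av ≠ ∞ :=
    ENNReal.mul_ne_top ENNReal.ofReal_ne_top ENNReal.ofReal_ne_top
  -- Subtraction is avoided: the mean arriving work times the average, which is finite, is added to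
  -- both sides.
  refine (ENNReal.add_le_add_iff_right hcancel).1 ?_
  rw [hKb] at hd
  have hsplit := add_le_add (add_le_add (le_refl (ENNReal.ofReal (systemLyapunov g u L b (t b) s)))
    (add_le_add hj.le hL.le)) (le_refl (t b * m * Λ * Av))
  rw [← hδs, hμ] at hsplit
  refine le_trans (le_of_eq ?_) (hd.trans (le_trans (le_of_eq ?_) hsplit))
  · ring
  · rw [← hμ]
    ring

end LLMServing

end

theorem mainTheorem2 {Z : Type*} [Finite Z] (K : ℕ) [NeZero K]
    (b : ℕ) (t : ℕ → ℕ) (ht_pos : ∀ n, 1 ≤ t n) (ht_mono : Monotone t)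
    (α : PMF ℕ) (ν : PMF (ℕ+ × ℕ+ × Z)) (lam mp md : ℝ)
    (hlam : HasSum (fun n : ℕ => (α n).toReal * (n : ℝ)) lam)
    (hmp : HasSum (fun v : ℕ+ × ℕ+ × Z => (ν v).toReal * ((v.1 : ℕ) : ℝ)) mp)
    (hmd : HasSum (fun v : ℕ+ × ℕ+ × Z => (ν v).toReal * ((v.2.1 : ℕ) : ℝ)) md)
    (ρ : LLMServing.Router K Z) (hρ : ρ.IsLoadBalancing)
    (Kp Kd : ℕ) (hKp : 1 ≤ Kp) (hKd : 1 ≤ Kd) (π : LLMServing.Scheduler Z b)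
    (X : Set (LLMServing.SystemState K Z))
    (hX : X = MarkovChain.stateSpace (LLMServing.step t α ν π ρ) (LLMServing.emptySystem K Z))
    (hwc : ∀ s ∈ X, ∀ k, (s k).remaining = 0 → π.WorkConservingAt (s k).queue)
    (hfcfs : ∀ s ∈ X, ∀ k, (s k).remaining = 0 → π.FCFSAt Kp Kd (s k).queue)
    (hirr : MarkovChain.IsIrreducibleOn (LLMServing.step t α ν π ρ) X)
    (hload : lam * (mp + md) < (K : ℝ) * (b : ℝ) / (t b : ℝ)) :
    MarkovChain.IsPositiveRecurrentOn (LLMServing.step t α ν π ρ) X := by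
  exact LLMServing.isPositiveRecurrentOn_stateSpace ht_pos ht_mono hlam hmp hmd hρ hX hwc hirr hload
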